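/- Let $(\Omega,\mathcal M,\mathbb P)$ be a probability space, $p\in[1,\infty)$, $\frac1p+\frac1q=1$, and write $\mathcal L^p,\mathcal L^q$ for the corresponding real Lebesgue spaces. Equip $\mathcal L^q$ with its norm topology if $q<\infty$ and with the weak-$*$ topology induced by $\mathcal L^1$ if $q=\infty$. A functional $\mathcal F:\mathcal L^p\to(-\infty,\infty]$ is closed if its sublevel sets $\{\mathcal F\le C\}$, $C\in\mathbb R$, are norm closed, and proper if it is not identically $\infty$. A closed convex functional $\mathcal F:\mathcal L^p\to(-\infty,\infty]$ is called * a subregular error measure if $\mathcal F\ge \mathcal F(0)=0$ and for every non-zero $X$ there is $\lambda>0$ with $\mathcal F(\lambda X)>0$; * a subregular regret measure if $\mathcal F(0)=0$, $\mathcal F(X)\ge\mathbb E[X]$ for all $X$, and for every non-zero $X$ there is $\lambda>0$ with $\mathcal F(\lambda X)>\mathbb E[\lambda X]$; * a subregular deviation measure if $\mathcal F\ge0$, $\mathcal F(C)=0$ for all constants $C$, and for every non-constant $X$ there is $\lambda>0$ with $\mathcal F(\lambda X)>0$; * a subregular risk measure if $\mathcal F(C)=C$ for all constants $C$, $\mathcal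 F(X)\ge\mathbb E[X]$ for all $X$, and for every non-constant $X$ there is $\lambda>0$ with $\mathcal F(\lambda X)>\mathbb E[\lambda X]$. Let $\mathcal F:\mathcal L^p\to(-\infty,\infty]$ be a closed proper convex functional, let $\mathcal F^*(Q)=\sup_{X\in\mathcal L^p}(\mathbb E[XQ]-\mathcal F(X))$ for $Q\in\mathcal L^q$ be its conjugate, and let $\operatorname{dom}\mathcal F^*=\{Q\in\mathcal L^q:\mathcal F^*(Q)<\infty\}$. Then: (i) $\mathcal F$ is a subregular error measure if and only if $\mathcal F^*(Q)\ge\mathcal F^*(0)=0$ for every $Q\in\mathcal L^q$, and for every non-zero $X\in\mathcal L^p$ there is $Q\in\operatorname{dom}\mathcal F^*$ with $\mathbb E[XQ]>0$. (ii) $\mathcal F$ is a subregular regret measure if and only if $\mathcal F^*(Q)\ge\mathcal F^*(1)=0$ for every $Q\in\mathcal L^q$, and for every non-zero $X\in\mathcal L^p$ there is $Q\in\operatorname{dom}\mathcal F^*$ with $\mathbb E[XQ]>\mathbb E[X]$. (iii) $\mathcal F$ is a subregular deviation measure if and only if $\mathcal F^*(Q)\ge\mathcal F^*(0)=0$ for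 every $Q\in\mathcal L^q$, $\mathbb E[Q]=0$ for every $Q\in\operatorname{dom}\mathcal F^*$, and for every non-constant $X\in\mathcal L^p$ there is $Q\in\operatorname{dom}\mathcal F^*$ with $\mathbb E[XQ]>0$. (iv) $\mathcal F$ is a subregular risk measure if and only if $\mathcal F^*(Q)\ge\mathcal F^*(1)=0$ for every $Q\in\mathcal L^q$, $\mathbb E[Q]=1$ for every $Q\in\operatorname{dom}\mathcal F^*$, and for every non-constant $X\in\mathcal L^p$ there is $Q\in\operatorname{dom}\mathcal F^*$ with $\mathbb E[XQ]>\mathbb E[X]$. Assume in addition that $\mathcal F$ is positively homogeneous, that is, $\mathcal F(\lambda X)=\lambda\mathcal F(X)$ for all $X\in\mathcal L^p$ and $\lambda\ge0$ (with $0\cdot\infty=0$), and let $\mathcal Q=\{Q\in\mathcal L^q:\mathbb E[QX]\le\mathcal F(X)\text{ for all }X\in\mathcal L^p\}$ be its risk envelope. Then $\mathcal Q=\operatorname{dom}\mathcal F^*$, and $\mathcal Q$ is the unique closed convex subset of $\mathcal L^q$ with $\mathcal F(X)=\sup_{Q\in\mathcal Q}\mathbb E[QX]$ for all $X\in\mathcal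 L^p$. For a convex set $\mathcal C\subseteq\mathcal L^q$, the quasi-interior of $\mathcal C$ consists of the points $x\in\mathcal C$ for which the cone $\{t(z-x):t\ge0,\ z\in\mathcal C\}$ is dense in $\mathcal L^q$; if $\mathcal C$ is contained in a closed hyperplane $H$, the quasi-interior of $\mathcal C$ relative to $H$ consists of the points $x\in\mathcal C$ for which the closure of this cone is $H-x$. Put $H_c=\{Q\in\mathcal L^q:\mathbb E[Q]=c\}$. In each of the following, the listed conditions are equivalent. (E$'$) (a) $\mathcal F$ is a subregular error measure; (b) $0\in\mathcal Q$ and for every non-zero $X\in\mathcal L^p$ there is $Q\in\mathcal Q$ with $\mathbb E[XQ]>0$; (c) $\mathcal Q$ is a closed convex set that contains $0$ in its quasi-interior; (d) $0\in\mathcal Q$ and every closed hyperplane containing $0$ has elements of $\mathcal Q$ in both of its associated open half-spaces. (V$'$) (a) $\mathcal F$ is a subregular regret measure; (b) $1\in\mathcal Q$ and for every non-zero $X\in\mathcal L^p$ there is $Q\in\mathcal Q$ with $\mathbb E[XQ]>\mathbb E[X]$; (c) $\mathcal Q$ is a closed convex set that contains $1$ in its quasi-interior; (d) $1\in\mathcal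 Q$ and every closed hyperplane containing $1$ has elements of $\mathcal Q$ in both of its associated open half-spaces. (D$'$) (a) $\mathcal F$ is a subregular deviation measure; (b) $0\in\mathcal Q$, $\mathbb E[Q]=0$ for every $Q\in\mathcal Q$, and for every non-constant $X\in\mathcal L^p$ there is $Q\in\mathcal Q$ with $\mathbb E[XQ]>0$; (c) $\mathcal Q$ is a closed convex subset of $H_0$ that contains $0$ in its quasi-interior relative to $H_0$; (d) $0\in\mathcal Q\subseteq H_0$ and every closed hyperplane $H\ne H_0$ containing $0$ has elements of $\mathcal Q$ in both of its associated open half-spaces. (R$'$) (a) $\mathcal F$ is a subregular risk measure; (b) $1\in\mathcal Q$, $\mathbb E[Q]=1$ for every $Q\in\mathcal Q$, and for every non-constant $X\in\mathcal L^p$ there is $Q\in\mathcal Q$ with $\mathbb E[XQ]>\mathbb E[X]$; (c) $\mathcal Q$ is a closed convex subset of $H_1$ that contains $1$ in its quasi-interior relative to $H_1$; (d) $1\in\mathcal Q\subseteq H_1$ and every closed hyperplane $H\ne H_1$ containing $1$ has elements of $\mathcal Q$ in both of its associated open half-spaces. -/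

import Mathlib

open MeasureTheory Topology
open scoped ENNReal

namespace RiskQuadrangle

noncomputable section

/-! ### Functionals on `L^p` with values in `(-∞, ∞]` -/

section Primal

variable {Ω : Type*} [MeasurableSpace Ω] {μ : Measure Ω} {p : ℝ≥0∞}

/-- The expectation `E[X]` of an element of `L^p`. -/
def expect (X : Lp ℝ p μ) : ℝ := ∫ ω, X ω ∂μ

/-- `X` is (almost surely equal to) a constant. -/
def IsConstant [IsFiniteMeasure μ] (X : Lp ℝ p μ) : Prop := ∃ c : ℝ, X = Lp.const p μ c

/-- A convex functional. The values are assumed to lie in `(-∞, ∞]` where this is used; `0 * ∞ = 0`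
in `EReal`. -/
def IsConvexFunctional (F : Lp ℝ p μ → EReal) : Prop :=
  ∀ X Y : Lp ℝ p μ, ∀ t : ℝ, 0 ≤ t → t ≤ 1 →
    F (t • X + (1 - t) • Y) ≤ (t : EReal) * F X + ((1 - t : ℝ) : EReal) * F Y

/-- A closed (lower semicontinuous) functional: the sublevel sets are closed in the norm
topology of `L^p`. -/
def IsClosedFunctional [Fact (1 ≤ p)] (F : Lp ℝ p μ → EReal) : Prop :=
  ∀ c : ℝ, IsClosed {X : Lp ℝ p μ | F X ≤ (c : EReal)}

/-- A closed convex functional `L^p → (-∞, ∞]`. -/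
structure IsClosedConvex [Fact (1 ≤ p)] (F : Lp ℝ p μ → EReal) : Prop where
  ne_bot : ∀ X, F X ≠ ⊥
  convex : IsConvexFunctional F
  closed : IsClosedFunctional F

/-- A closed proper convex functional `L^p → (-∞, ∞]`: not identically `∞`. -/
structure IsClosedProperConvex [Fact (1 ≤ p)] (F : Lp ℝ p μ → EReal) : Prop
    extends IsClosedConvex F where
  proper : ∃ X, F X ≠ ⊤

/-- Subregular error measure. -/
structure IsSubregularError [Fact (1 ≤ p)] (F : Lp ℝ p μ → EReal) : Prop
    extends IsClosedConvex F where
  map_zero : F 0 = 0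
  nonneg : ∀ X, 0 ≤ F X
  averse : ∀ X, X ≠ 0 → ∃ t : ℝ, 0 < t ∧ 0 < F (t • X)

/-- Subregular regret measure. -/
structure IsSubregularRegret [Fact (1 ≤ p)] (F : Lp ℝ p μ → EReal) : Prop
    extends IsClosedConvex F where
  map_zero : F 0 = 0
  expect_le : ∀ X, (expect X : EReal) ≤ F X
  averse : ∀ X, X ≠ 0 → ∃ t : ℝ, 0 < t ∧ (expect (t • X) : EReal) < F (t • X)

/-- Subregular deviation measure. -/
structure IsSubregularDeviation [IsFiniteMeasure μ] [Fact (1 ≤ p)] (F : Lp ℝ p μ → EReal) : Prop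
    extends IsClosedConvex F where
  map_const : ∀ c : ℝ, F (Lp.const p μ c) = 0
  nonneg : ∀ X, 0 ≤ F X
  averse : ∀ X, ¬ IsConstant X → ∃ t : ℝ, 0 < t ∧ 0 < F (t • X)

/-- Subregular risk measure. -/
structure IsSubregularRisk [IsFiniteMeasure μ] [Fact (1 ≤ p)] (F : Lp ℝ p μ → EReal) : Prop
    extends IsClosedConvex F where
  map_const : ∀ c : ℝ, F (Lp.const p μ c) = (c : EReal)
  expect_le : ∀ X, (expect X : EReal) ≤ F X
  averse : ∀ X, ¬ IsConstant X → ∃ t : ℝ, 0 < t ∧ (expect (t • X) : EReal) < F (t • X)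

/-- Positive homogeneity; with `t = 0` it contains `F 0 = 0`. -/
def IsPosHomogeneous (F : Lp ℝ p μ → EReal) : Prop :=
  ∀ X : Lp ℝ p μ, ∀ t : ℝ, 0 ≤ t → F (t • X) = (t : EReal) * F X

end Primal

/-! ### The pairing of `L^p` and `L^q`, conjugates and envelopes -/

section Dual

variable {Ω : Type*} [MeasurableSpace Ω] {μ : Measure Ω} {p q : ℝ≥0∞}

/-- The pairing `E[XQ]` of `X ∈ L^p` and `Q ∈ L^q`. -/
def pairing (X : Lp ℝ p μ) (Q : Lp ℝ q μ) : ℝ := ∫ ω, X ω * Q ω ∂μ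

/-- The conjugate functional `F*(Q) = sup_X (E[XQ] - F(X))` on `L^q`. -/
def conjugate (F : Lp ℝ p μ → EReal) (Q : Lp ℝ q μ) : EReal :=
  ⨆ X : Lp ℝ p μ, ((pairing X Q : EReal) - F X)

/-- The effective domain of a functional. -/
def effDom (G : Lp ℝ q μ → EReal) : Set (Lp ℝ q μ) := {Q | G Q < ⊤}

/-- The risk envelope of `F` in `L^q`. -/
def riskEnvelope (q : ℝ≥0∞) (F : Lp ℝ p μ → EReal) : Set (Lp ℝ q μ) :=
  {Q | ∀ X : Lp ℝ p μ, (pairing X Q : EReal) ≤ F X}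

/-- The topology carried by `L^q` as the dual of `L^p`: the norm topology if `q < ∞`, and the
weak-* topology induced by `L^p` if `q = ∞` (that is, `p = 1`). -/
@[reducible] def dualTopology (p q : ℝ≥0∞) [Fact (1 ≤ q)] (μ : Measure Ω) : TopologicalSpace (Lp ℝ q μ) :=
  if q = ∞ then
    TopologicalSpace.induced (fun (Q : Lp ℝ q μ) (X : Lp ℝ p μ) => pairing X Q)
      (inferInstance : TopologicalSpace (Lp ℝ p μ → ℝ))
  else (inferInstance : TopologicalSpace (Lp ℝ q μ))

/-- The hyperplane `{Q ∈ L^q | E[Q] = c}`. -/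
def expectHyperplane (q : ℝ≥0∞) (μ : Measure Ω) (c : ℝ) : Set (Lp ℝ q μ) := {Q | expect Q = c}

end Dual

/-! ### Quasi-interior and closed hyperplanes, for a given topology on a real vector space -/

section Geometry

variable {E : Type*} [AddCommGroup E] [Module ℝ E]

/-- The cone generated by `C - x`. -/
def coneAt (C : Set E) (x : E) : Set E := {y | ∃ t : ℝ, 0 ≤ t ∧ ∃ z ∈ C, y = t • (z - x)}

/-- The quasi-interior of a convex set `C`: the points `x ∈ C` for which the cone generated by
`C - x` is dense. -/
def quasiInterior (τ : TopologicalSpace E) (C : Set E) : Set E :=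
  {x | x ∈ C ∧ @closure E τ (coneAt C x) = Set.univ}

/-- The quasi-interior of a convex set `C` relative to a closed affine subspace `H ⊇ C`: the points
`x ∈ C` for which the closed cone generated by `C - x` is the linear subspace `H - x`. -/
def quasiInteriorIn (τ : TopologicalSpace E) (H C : Set E) : Set E :=
  {x | x ∈ C ∧ @closure E τ (coneAt C x) = {y | y + x ∈ H}}

/-- Every closed hyperplane `H = {z | ℓ z = c}` containing `x` has elements of `C` in both of its
associated open half-spaces. -/
def HyperplanesCut (τ : TopologicalSpace E) (C : Set E) (x : E) : Prop :=
  ∀ (l : E →ₗ[ℝ] ℝ) (c : ℝ), l ≠ 0 → @Continuous E ℝ τ _ l → x ∈ {z | l z = c} →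
    (∃ z ∈ C, l z < c) ∧ (∃ z ∈ C, c < l z)

/-- Every closed hyperplane `H = {z | ℓ z = c}` with `H ≠ H₀` that contains `x` has elements of `C`
in both of its associated open half-spaces. -/
def HyperplanesCutExcept (τ : TopologicalSpace E) (H₀ C : Set E) (x : E) : Prop :=
  ∀ (l : E →ₗ[ℝ] ℝ) (c : ℝ), l ≠ 0 → @Continuous E ℝ τ _ l → x ∈ {z | l z = c} →
    {z | l z = c} ≠ H₀ →
    (∃ z ∈ C, l z < c) ∧ (∃ z ∈ C, c < l z)

end Geometry

end

end RiskQuadrangle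

open RiskQuadrangle

/-!
All four kinds of subregular measures are instances of one notion in the dual pair of `L^p` and
`L^q`. Fix `a ∈ L^q` and a subspace `K` of `L^p`; call `F` *averse* (`IsAverse`) if `F` dominates
`⟨·, a⟩ = E[· a]`, agrees with it on `K`, and exceeds it somewhere on every ray outside `K`. Error
and regret measures are the cases `K = 0` with `a = 0` and `a = 1`; deviation and risk measures are
the same with `K` the constants.

A closed proper convex functional is the supremum of its affine minorants `⟨·, Q⟩ - b` with
`Q ∈ L^q` (`IsClosedProperConvex.isSupOfAffineMinorants`). This combines the Fenchel–Moreau theorem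
(`exists_affine_minorant`, separation from the epigraph) with the Riesz representation of the dual
of `L^p` for `p < ∞` (`exists_eq_pairing`). Since `F*(Q) ≤ b` says exactly that `⟨·, Q⟩ - b` is a
minorant, aversity becomes a statement on minorants (`isAverse_iff_minorants`): `⟨·, a⟩` is one, all
offsets `b` are non-negative, every slope `Q` lies in the affine subspace `H = a + Kᗮ`, and for
`X ∉ K` some slope has `⟨X, Q⟩ > ⟨X, a⟩`. For the last point, scaling `X` makes the offset
negligible. This is the characterization through the conjugate.

If `F` is positively homogeneous, the offset of a minorant may be replaced by `0`, so the slopes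
form the envelope `𝒬`, which is closed and convex, and separation shows that no other closed convex set
has `F` as its support function. The topology of `L^q` enters only through the fact that it is
locally convex with continuous functionals `⟨X, ·⟩`, `X ∈ L^p`
(`isCompatibleTopology_dualTopology`).
By separation, the cone generated by `𝒬 - a` is dense in `H - a` exactly if no `X ∉ K` satisfies
`⟨X, Q⟩ ≤ ⟨X, a⟩` on `𝒬` (`mem_quasiInteriorIn_iff`); applied to `X` and `-X`, the same condition
says that the hyperplanes through `a` other than `H` cut `𝒬` (`hyperplanesCutExcept_iff`).
-/

namespace RiskQuadrangle

/-! ### Affine minorants of closed proper convex functionals -/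

section Minorant

variable {V W : Type*} [AddCommGroup V] [Module ℝ V] [AddCommGroup W] [Module ℝ W]

/-- The affine function `X ↦ B X Q - b` is a minorant of `F`. -/
def IsAffineMinorant (B : V →ₗ[ℝ] W →ₗ[ℝ] ℝ) (F : V → EReal) (Q : W) (b : ℝ) : Prop :=
  ∀ X, ((B X Q - b : ℝ) : EReal) ≤ F X

theorem isAffineMinorant_iff_iSup_le {B : V →ₗ[ℝ] W →ₗ[ℝ] ℝ} {F : V → EReal}
    (hbot : ∀ X, F X ≠ ⊥) {Q : W} {b : ℝ} :
    IsAffineMinorant B F Q b ↔ ⨆ X, ((B X Q : EReal) - F X) ≤ b := by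
  rw [iSup_le_iff]
  refine forall_congr' fun X => ?_
  have h := hbot X
  induction hx : F X with
  | bot => exact absurd hx h
  | top => simp
  | coe x =>
    norm_cast
    constructor <;> intro h' <;> linarith

/-- A closed proper convex functional is the supremum of its continuous affine minorants: a point
strictly below the graph is separated from the epigraph by a hyperplane, which can be tilted if it
is vertical. -/
theorem exists_affine_minorant [TopologicalSpace V] [IsTopologicalAddGroup V]
    [ContinuousSMul ℝ V] [LocallyConvexSpace ℝ V] {F : V → EReal} (hbot : ∀ X, F X ≠ ⊥)
    (hconv : ∀ X Y : V, ∀ t : ℝ, 0 ≤ t → t ≤ 1 →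
      F (t • X + (1 - t) • Y) ≤ (t : EReal) * F X + ((1 - t : ℝ) : EReal) * F Y)
    (hclosed : ∀ c : ℝ, IsClosed {X | F X ≤ (c : EReal)}) (hproper : ∃ X, F X ≠ ⊤)
    {X : V} {r : ℝ} (hr : (r : EReal) < F X) :
    ∃ (l : StrongDual ℝ V) (b : ℝ), r < l X - b ∧ ∀ Z, ((l Z - b : ℝ) : EReal) ≤ F Z := by
  set E : Set (V × ℝ) := {z | F z.1 ≤ (z.2 : EReal)} with hE
  have hlsc : LowerSemicontinuous F := by
    rw [lowerSemicontinuous_iff_isClosed_preimage]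
    intro y
    induction y with
    | bot =>
      have : F ⁻¹' Set.Iic ⊥ = ∅ := by
        ext Z; simpa using hbot Z
      rw [this]; exact isClosed_empty
    | top => simp
    | coe c => exact hclosed c
  have hEc : IsClosed E := hlsc.isClosed_epigraph.preimage
    (f := fun z : V × ℝ => (z.1, (z.2 : EReal)))
    (continuous_fst.prodMk (continuous_coe_real_ereal.comp continuous_snd))
  have hEconv : Convex ℝ E := by
    rintro ⟨Z, s⟩ hZ ⟨Z', s'⟩ hZ' t t' ht ht' htt
    obtain rfl : t' = 1 - t := by linarith
    refine (hconv Z Z' t ht (by linarith)).trans ?_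
    have h1 : (t : EReal) * F Z ≤ (t : EReal) * s :=
      mul_le_mul_of_nonneg_left hZ (by exact_mod_cast ht)
    have h2 : ((1 - t : ℝ) : EReal) * F Z' ≤ ((1 - t : ℝ) : EReal) * s' :=
      mul_le_mul_of_nonneg_left hZ' (by exact_mod_cast ht')
    refine (add_le_add h1 h2).trans ?_
    simp only [Prod.smul_mk, Prod.mk_add_mk, smul_eq_mul]
    norm_cast
  -- Separation of `(Y, s)` from the epigraph, with the slope `α` in the vertical direction.
  have sep : ∀ (Y : V) (s : ℝ), (s : EReal) < F Y → ∃ (l : StrongDual ℝ V) (α u : ℝ), 0 ≤ α ∧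
      l Y + α * s < u ∧ ∀ Z (x : ℝ), F Z ≤ x → u < l Z + α * x := by
    intro Y s hs
    obtain ⟨f, u, hfu, huf⟩ := geometric_hahn_banach_point_closed hEconv hEc
      (x := (Y, s)) (by simpa [hE] using hs)
    have hf : ∀ Z x, f (Z, x) = f (Z, 0) + f (0, 1) * x := by
      intro Z x
      have : (Z, x) = (Z, (0 : ℝ)) + x • ((0 : V), (1 : ℝ)) := by simp
      rw [this, map_add, map_smul, smul_eq_mul, mul_comm]
    refine ⟨f.comp (ContinuousLinearMap.inl ℝ V ℝ), f (0, 1), u, ?_, ?_, ?_⟩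
    · obtain ⟨X₀, hX₀⟩ := hproper
      by_contra! hneg
      lift F X₀ to ℝ using ⟨hX₀, hbot X₀⟩ with x₀ hx₀
      have key : ∀ x, x₀ ≤ x → u < f (X₀, 0) + f (0, 1) * x := fun x hx => by
        rw [← hf]; exact huf _ (by simp only [hE, Set.mem_ofPred_eq, ← hx₀]; exact_mod_cast hx)
      have h1 := key (max x₀ ((u - f (X₀, 0)) / f (0, 1))) (le_max_left _ _)
      have h2 := mul_le_mul_of_nonpos_left
        (le_max_right x₀ ((u - f (X₀, 0)) / f (0, 1))) hneg.le
      rw [mul_div_cancel₀ _ hneg.ne] at h2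
      linarith
    · simpa [← hf] using hfu
    · intro Z x hZ
      simpa [← hf] using huf (Z, x) hZ
  -- A separating functional with positive vertical slope is an affine minorant.
  have pos : ∀ (Y : V) (s : ℝ) (l : StrongDual ℝ V) (α u : ℝ), 0 < α → l Y + α * s < u →
      (∀ Z (x : ℝ), F Z ≤ x → u < l Z + α * x) →
      ∃ (l : StrongDual ℝ V) (b : ℝ), s < l Y - b ∧ ∀ Z, ((l Z - b : ℝ) : EReal) ≤ F Z := by
    intro Y s l α u hα h1 h2
    have hb : ∀ Z, (-α⁻¹ • l) Z - (-(α⁻¹ * u)) = (u - l Z) / α := by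
      intro Z; simp; field_simp; ring
    refine ⟨-α⁻¹ • l, -(α⁻¹ * u), ?_, fun Z => ?_⟩
    · rw [hb, lt_div_iff₀ hα]; linarith
    · rw [hb]
      induction hZ : F Z with
      | bot => exact absurd hZ (hbot Z)
      | top => exact le_top
      | coe x =>
        have := h2 Z x hZ.le
        norm_cast
        rw [div_le_iff₀ hα]; linarith
  obtain ⟨l, α, u, hα, h1, h2⟩ := sep X r hr
  rcases hα.lt_or_eq with hα | rfl
  · exact pos X r l α u hα h1 h2
  -- The hyperplane is vertical: it is tilted by an affine minorant `l' - b'`.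
  obtain ⟨X₀, hX₀⟩ := hproper
  lift F X₀ to ℝ using ⟨hX₀, hbot X₀⟩ with x₀ hx₀
  obtain ⟨l₀, α₀, u₀, hα₀, h1₀, h2₀⟩ := sep X₀ (x₀ - 1) (by rw [← hx₀]; norm_cast; linarith)
  have hα₀' : 0 < α₀ := by
    rcases hα₀.lt_or_eq with h | rfl
    · exact h
    · have := h2₀ X₀ x₀ hx₀.ge
      linarith
  obtain ⟨l', b', -, hl'⟩ := pos _ _ l₀ α₀ u₀ hα₀' h1₀ h2₀
  simp only [zero_mul, add_zero] at h1 h2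
  have hpos : 0 < u - l X := by linarith
  -- With this factor, the multiple of `u - l` added to `l' - b'` lifts it above `r` at `X`.
  set t : ℝ := (max 0 (r - (l' X - b')) + 1) / (u - l X) with ht
  have htpos : 0 ≤ t := by positivity
  have htX : t * (u - l X) = max 0 (r - (l' X - b')) + 1 := div_mul_cancel₀ _ hpos.ne'
  refine ⟨l' - t • l, b' - t * u, ?_, fun Z => ?_⟩
  · have := le_max_right 0 (r - (l' X - b'))
    simp only [sub_apply, smul_apply, smul_eq_mul]
    nlinarith
  · have hZ' := hl' Z
    induction hZ : F Z with
    | bot => exact absurd hZ (hbot Z)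
    | top => exact le_top
    | coe x =>
      rw [hZ] at hZ'
      norm_cast at hZ' ⊢
      have := mul_nonneg htpos (sub_nonneg.2 (h2 Z x hZ.le).le)
      simp only [sub_apply, smul_apply, smul_eq_mul]
      linarith

/-- The slope of an affine minorant of a positively homogeneous functional is a linear minorant. -/
theorem IsAffineMinorant.of_posHomogeneous {B : V →ₗ[ℝ] W →ₗ[ℝ] ℝ} {F : V → EReal}
    (hom : ∀ X : V, ∀ t : ℝ, 0 ≤ t → F (t • X) = (t : EReal) * F X) {Q : W} {b : ℝ}
    (h : IsAffineMinorant B F Q b) : 0 ≤ b ∧ IsAffineMinorant B F Q 0 := by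
  have h0 : F 0 = 0 := by simpa using hom 0 0 le_rfl
  have hb : 0 ≤ b := by
    have h' := h 0
    rw [h0] at h'
    norm_cast at h'
    simpa using h'
  refine ⟨hb, fun X => ?_⟩
  induction hX : F X with
  | bot => have := h X; rw [hX] at this; exact absurd (le_bot_iff.1 this) (EReal.coe_ne_bot _)
  | top => exact le_top
  | coe x =>
    norm_cast
    rw [sub_zero]
    by_contra! hlt
    have hpos : 0 < B X Q - x := by linarith
    have h' := h (((b + 1) / (B X Q - x)) • X)
    rw [hom X _ (by positivity), hX] at h'
    norm_cast at h'
    have : (b + 1) / (B X Q - x) * (B X Q - x) = b + 1 := div_mul_cancel₀ _ hpos.ne'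
    simp only [map_smul, LinearMap.smul_apply, smul_eq_mul] at h'
    linarith

end Minorant

/-! ### Quasi-interiors and hyperplanes in a dual pair -/

section DualPair

variable {V W : Type*} [AddCommGroup V] [Module ℝ V] [AddCommGroup W] [Module ℝ W]

/-- A locally convex vector topology on `W` whose continuous linear functionals are exactly the
functionals `B X` with `X ∈ V`. -/
structure IsCompatibleTopology (τ : TopologicalSpace W) (B : V →ₗ[ℝ] W →ₗ[ℝ] ℝ) : Prop where
  isTopologicalAddGroup : @IsTopologicalAddGroup W τ _
  continuousSMul : @ContinuousSMul ℝ W _ _ τ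
  locallyConvexSpace : @LocallyConvexSpace ℝ W _ _ _ _ τ
  continuous_iff : ∀ l : W →ₗ[ℝ] ℝ, @Continuous W ℝ τ _ l ↔ ∃ X, l = B X

variable {τ : TopologicalSpace W} {B : V →ₗ[ℝ] W →ₗ[ℝ] ℝ}

theorem IsCompatibleTopology.continuous (hτ : IsCompatibleTopology τ B) (X : V) :
    @Continuous W ℝ τ _ (B X) := (hτ.continuous_iff _).2 ⟨X, rfl⟩

theorem IsCompatibleTopology.exists_separating (hτ : IsCompatibleTopology τ B) {C : Set W}
    (hconv : Convex ℝ C) (hC : IsClosed[τ] C) {w : W} (hw : w ∉ C) :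
    ∃ (X : V) (u : ℝ), (∀ z ∈ C, B X z < u) ∧ u < B X w := by
  have := hτ.isTopologicalAddGroup
  have := hτ.continuousSMul
  have := hτ.locallyConvexSpace
  obtain ⟨f, u, hf, hu⟩ := geometric_hahn_banach_closed_point hconv hC hw
  obtain ⟨X, hX⟩ := (hτ.continuous_iff f.toLinearMap).1 f.continuous
  have hX' : ∀ z, f z = B X z := fun z => DFunLike.congr_fun hX z
  exact ⟨X, u, fun z hz => hX' z ▸ hf z hz, hX' w ▸ hu⟩

theorem IsCompatibleTopology.isClosed_linearMinorants (hτ : IsCompatibleTopology τ B)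
    (F : V → EReal) : IsClosed[τ] {Q | IsAffineMinorant B F Q 0} := by
  simp only [IsAffineMinorant, sub_zero, Set.ofPred_forall]
  refine isClosed_iInter fun X => ?_
  exact isClosed_le (continuous_coe_real_ereal.comp (hτ.continuous X)) continuous_const

theorem convex_linearMinorants (B : V →ₗ[ℝ] W →ₗ[ℝ] ℝ) (F : V → EReal) :
    Convex ℝ {Q | IsAffineMinorant B F Q 0} := by
  intro Q hQ Q' hQ' s t hs ht hst X
  have h1 := hQ X
  have h2 := hQ' X
  simp only [sub_zero, map_add, map_smul, smul_eq_mul] at *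
  induction hX : F X with
  | bot => rw [hX] at h1; exact absurd (le_bot_iff.1 h1) (EReal.coe_ne_bot _)
  | top => exact le_top
  | coe x =>
    rw [hX] at h1 h2
    norm_cast at *
    calc s * B X Q + t * B X Q' ≤ s * x + t * x := by gcongr
      _ = x := by rw [← add_mul, hst, one_mul]

theorem convex_coneAt {C : Set W} (hC : Convex ℝ C) {x : W} : Convex ℝ (coneAt C x) := by
  rintro _ ⟨s, hs, z, hz, rfl⟩ _ ⟨s', hs', z', hz', rfl⟩ t t' ht ht' -
  rcases eq_or_lt_of_le (add_nonneg (mul_nonneg ht hs) (mul_nonneg ht' hs')) with h0 | hpos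
  · have h1 : t * s = 0 := by linarith [mul_nonneg ht hs, mul_nonneg ht' hs']
    have h2 : t' * s' = 0 := by linarith [mul_nonneg ht hs, mul_nonneg ht' hs']
    exact ⟨0, le_rfl, z, hz, by simp [smul_smul, h1, h2]⟩
  · refine ⟨t * s + t' * s', hpos.le,
      (t * s / (t * s + t' * s')) • z + (t' * s' / (t * s + t' * s')) • z',
      hC hz hz' (by positivity) (by positivity) (by field_simp), ?_⟩
    simp only [smul_sub, smul_add, smul_smul, mul_div_cancel₀ _ hpos.ne', add_smul]
    abel

/-- A point `a` of a convex set `C` is in the quasi-interior of `C` relative to the affine subspace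
`H = a + Kᗮ` exactly if every functional outside `K` takes larger values on `C` than at `a`. -/
theorem mem_quasiInteriorIn_iff (hτ : IsCompatibleTopology τ B) (K : Submodule ℝ V)
    {a : W} {H C : Set W} (hH : ∀ w, w ∈ H ↔ ∀ X ∈ K, B X w = B X a)
    (hK : ∀ X, (∀ w, w + a ∈ H → B X w = 0) → X ∈ K)
    (hC : Convex ℝ C) (hCH : C ⊆ H) (haC : a ∈ C) :
    a ∈ quasiInteriorIn τ H C ↔ ∀ X, X ∉ K → ∃ Q ∈ C, B X a < B X Q := by
  have hH' : ∀ y, y + a ∈ H ↔ ∀ X ∈ K, B X y = 0 := fun y => by simp [hH]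
  constructor
  · rintro ⟨-, hcl⟩ X hX
    by_contra! hle
    have hneg : ∀ X, (∀ Q ∈ C, B X Q ≤ B X a) → ∀ y, y + a ∈ H → B X y ≤ 0 := by
      intro X hle y hy
      have hy' : y ∈ @closure W τ (coneAt C a) := by rw [hcl]; exact hy
      refine @closure_minimal W τ _ {y | B X y ≤ 0} ?_
        (isClosed_le (hτ.continuous X) continuous_const) y hy'
      rintro _ ⟨t, ht, z, hz, rfl⟩
      have := hle z hz
      simp only [Set.mem_ofPred_eq, map_smul, map_sub, smul_eq_mul]
      exact mul_nonpos_of_nonneg_of_nonpos ht (by linarith)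
    refine hX (hK X fun y hy => le_antisymm (hneg X hle y hy) ?_)
    have hy' : -y + a ∈ H := (hH' _).2 fun Z hZ => by simpa using (hH' y).1 hy Z hZ
    simpa using hneg X hle (-y) hy'
  · intro h
    refine ⟨haC, Set.Subset.antisymm ?_ fun y hy => ?_⟩
    · refine @closure_minimal W τ _ _ ?_ ?_
      · rintro _ ⟨t, ht, z, hz, rfl⟩
        refine (hH' _).2 fun X hX => ?_
        simp [(hH z).1 (hCH hz) X hX]
      · have : {y | y + a ∈ H} = ⋂ X ∈ K, {y | B X y = 0} := by ext y; simp [hH']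
        rw [this]
        exact isClosed_biInter fun X _ => isClosed_eq (hτ.continuous X) continuous_const
    · by_contra hyn
      have hcc : Convex ℝ (@closure W τ (coneAt C a)) := by
        have := hτ.isTopologicalAddGroup
        have := hτ.continuousSMul
        exact (convex_coneAt hC).closure
      obtain ⟨X, u, hX, hu⟩ := hτ.exists_separating hcc (@isClosed_closure W τ _) hyn
      have hcone : ∀ t : ℝ, 0 ≤ t → ∀ z ∈ C, t * (B X z - B X a) < u := fun t ht z hz => by
        simpa using hX _ (@subset_closure W τ _ _ ⟨t, ht, z, hz, rfl⟩)
      have hu0 : 0 < u := by simpa using hcone 0 le_rfl a haC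
      have hXK : X ∉ K := fun hXK => by
        have := (hH' y).1 hy X hXK
        linarith
      obtain ⟨Q, hQ, hlt⟩ := h X hXK
      have hpos : 0 < B X Q - B X a := by linarith
      have := hcone (u / (B X Q - B X a)) (by positivity) Q hQ
      rw [div_mul_cancel₀ _ hpos.ne'] at this
      exact lt_irrefl _ this

/-- The hyperplanes through `a` are the level sets of the functionals `B X`, and those other than
`H` belong to the `X ∉ K`; the two half-spaces correspond to `X` and `-X`. -/
theorem hyperplanesCutExcept_iff (hτ : IsCompatibleTopology τ B) (K : Submodule ℝ V)
    {a : W} {H C : Set W}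
    (hK : ∀ X, X ∈ K ↔ B X = 0 ∨ {w | B X w = B X a} = H) :
    HyperplanesCutExcept τ H C a ↔ ∀ X, X ∉ K → ∃ Q ∈ C, B X a < B X Q := by
  constructor
  · intro h X hX
    rw [hK, not_or] at hX
    exact (h (B X) (B X a) hX.1 (hτ.continuous X) rfl hX.2).2
  · rintro h l c hl0 hl rfl hne
    obtain ⟨X, rfl⟩ := (hτ.continuous_iff l).1 hl
    have hXK : X ∉ K := by rw [hK, not_or]; exact ⟨hl0, hne⟩
    obtain ⟨Q, hQ, hlt⟩ := h (-X) (by simpa using hXK)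
    exact ⟨⟨Q, hQ, by simpa using hlt⟩, h X hXK⟩

theorem quasiInterior_eq_quasiInteriorIn_univ (τ : TopologicalSpace W) (C : Set W) :
    quasiInterior τ C = quasiInteriorIn τ Set.univ C := by
  simp [quasiInterior, quasiInteriorIn]

theorem hyperplanesCut_iff_hyperplanesCutExcept_univ (τ : TopologicalSpace W) (C : Set W) (a : W) :
    HyperplanesCut τ C a ↔ HyperplanesCutExcept τ Set.univ C a := by
  refine ⟨fun h l c hl hc ha _ => h l c hl hc ha, fun h l c hl hc ha => h l c hl hc ha ?_⟩
  intro hu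
  have hall : ∀ z, l z = c := fun z => by
    have : z ∈ {z | l z = c} := hu ▸ Set.mem_univ z
    exact this
  refine hl (LinearMap.ext fun z => ?_)
  rw [hall z, ← hall 0, map_zero, LinearMap.zero_apply]

end DualPair

/-! ### The dual of `L^p` -/

section LpDual

variable {Ω : Type*} [MeasurableSpace Ω] {μ : Measure Ω} {p q : ℝ≥0∞}

section Pairing

variable [Fact (1 ≤ p)] [Fact (1 ≤ q)] [ENNReal.HolderConjugate p q]

/-- The pairing of `L^p` and `L^q` as a continuous bilinear map. -/
noncomputable def pairingCLM (p q : ℝ≥0∞) [Fact (1 ≤ p)] [Fact (1 ≤ q)]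
    [ENNReal.HolderConjugate p q] (μ : Measure Ω) : Lp ℝ p μ →L[ℝ] Lp ℝ q μ →L[ℝ] ℝ :=
  (ContinuousLinearMap.mul ℝ ℝ).lpPairing μ p q

theorem pairingCLM_apply (X : Lp ℝ p μ) (Q : Lp ℝ q μ) : pairingCLM p q μ X Q = pairing X Q := by
  simp [pairingCLM, ContinuousLinearMap.lpPairing_eq_integral, pairing]

/-- The pairing of `L^p` and `L^q` as a bilinear map. -/
noncomputable def pairingₗ (p q : ℝ≥0∞) [Fact (1 ≤ p)] [Fact (1 ≤ q)]
    [ENNReal.HolderConjugate p q] (μ : Measure Ω) : Lp ℝ p μ →ₗ[ℝ] Lp ℝ q μ →ₗ[ℝ] ℝ :=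
  LinearMap.mk₂ ℝ pairing
    (fun X Y Q => by simp [← pairingCLM_apply])
    (fun c X Q => by simp [← pairingCLM_apply])
    (fun X Q R => by simp [← pairingCLM_apply])
    (fun c X Q => by simp [← pairingCLM_apply])

@[simp]
theorem pairingₗ_apply (X : Lp ℝ p μ) (Q : Lp ℝ q μ) : pairingₗ p q μ X Q = pairing X Q := rfl

end Pairing

theorem pairing_comm (X : Lp ℝ p μ) (Q : Lp ℝ q μ) : pairing X Q = pairing Q X := by
  simp only [pairing, mul_comm]

theorem pairing_indicatorConstLp {A : Set Ω} (hA : MeasurableSet A) (hμA : μ A ≠ ∞)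
    (Q : Lp ℝ q μ) : pairing (indicatorConstLp p hA hμA (1 : ℝ)) Q = ∫ ω in A, Q ω ∂μ := by
  rw [pairing, ← integral_indicator hA]
  refine integral_congr_ae ?_
  filter_upwards [indicatorConstLp_coeFn (p := p) (hs := hA) (hμs := hμA) (c := (1 : ℝ))] with ω hω
  rw [hω]
  by_cases h : ω ∈ A <;> simp [h]

theorem pairing_const_left [IsFiniteMeasure μ] (c : ℝ) (Q : Lp ℝ q μ) :
    pairing (Lp.const p μ c) Q = c * expect Q := by
  rw [pairing, expect, ← integral_const_mul]
  refine integral_congr_ae ?_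
  filter_upwards [Lp.coeFn_const p μ c] with ω hω
  rw [hω, Function.const_apply]

theorem pairing_const_right [IsFiniteMeasure μ] (X : Lp ℝ p μ) (c : ℝ) :
    pairing X (Lp.const q μ c) = c * expect X := by
  rw [pairing_comm, pairing_const_left]

/-- A continuous linear functional on `L^p`, `p < ∞`, is determined by its values at indicators. -/
theorem Lp_strongDual_ext [Fact (1 ≤ p)] [IsFiniteMeasure μ] (hp : p ≠ ∞)
    {φ ψ : StrongDual ℝ (Lp ℝ p μ)}
    (h : ∀ A (hA : MeasurableSet A), φ (indicatorConstLp p hA (measure_ne_top μ A) 1) =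
      ψ (indicatorConstLp p hA (measure_ne_top μ A) 1)) : φ = ψ := by
  ext X
  induction X using Lp.induction hp with
  | @indicatorConst c A hs hμs =>
    rw [Lp.simpleFunc.coe_indicatorConst]
    have : indicatorConstLp p hs hμs.ne c = c • indicatorConstLp p hs hμs.ne (1 : ℝ) := by
      rw [indicatorConstLp, indicatorConstLp, ← MemLp.toLp_const_smul]
      refine MemLp.toLp_congr _ _ (Filter.Eventually.of_forall fun ω => ?_)
      by_cases hω : ω ∈ A <;> simp [hω]
    rw [this, map_smul, map_smul, h]
  | add hf hg _ h1 h2 => rw [map_add, map_add, h1, h2]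
  | isClosed => exact isClosed_eq φ.continuous ψ.continuous

/-- The signed measure `A ↦ φ(1_A)` of a continuous linear functional `φ` on `L^p`, `p < ∞`. -/
theorem exists_signedMeasure_of_strongDual [Fact (1 ≤ p)] [IsFiniteMeasure μ] (hp : p ≠ ∞)
    (φ : StrongDual ℝ (Lp ℝ p μ)) : ∃ ν : SignedMeasure Ω, ∀ A (hA : MeasurableSet A),
      ν A = φ (indicatorConstLp p hA (measure_ne_top μ A) 1) := by
  classical
  let I : Set Ω → ℝ := fun A =>
    if hA : MeasurableSet A then φ (indicatorConstLp p hA (measure_ne_top μ A) 1) else 0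
  have hI : ∀ A (hA : MeasurableSet A),
      I A = φ (indicatorConstLp p hA (measure_ne_top μ A) 1) := fun A hA => dif_pos hA
  have hI0 : I ∅ = 0 := by
    rw [hI _ MeasurableSet.empty, indicatorConstLp_empty, map_zero]
  refine ⟨⟨I, hI0, fun A hA => dif_neg hA, fun f hf hd => ?_⟩, hI⟩
  have hmeas : ∀ s : Finset ℕ, MeasurableSet (⋃ i ∈ s, f i) := fun s =>
    s.measurableSet_biUnion fun i _ => hf i
  have hsum : ∀ s : Finset ℕ, ∑ i ∈ s, I (f i) =
      φ (indicatorConstLp p (hmeas s) (measure_ne_top μ _) 1) := by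
    intro s
    rw [← hI]
    induction s using Finset.induction_on with
    | empty => simp [hI0]
    | insert i s his ih =>
      have hdis : Disjoint (f i) (⋃ j ∈ s, f j) := by
        simp only [Set.disjoint_iUnion_right]
        exact fun j hj => hd fun h => his (h ▸ hj)
      rw [Finset.sum_insert his, ih, Finset.set_biUnion_insert, hI _ (hf i), hI _ (hmeas s),
        hI _ ((hf i).union (hmeas s)), ← map_add,
        indicatorConstLp_disjoint_union (hf i) (hmeas s) _ _ hdis]
  have htail : Filter.Tendsto (fun s : Finset ℕ => μ (symmDiff (⋃ i ∈ s, f i) (⋃ i, f i)))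
      Filter.atTop (𝓝 0) := by
    have hfin : ∑' i, μ (f i) ≠ ∞ := by
      rw [← measure_iUnion hd hf]; exact measure_ne_top _ _
    refine tendsto_of_tendsto_of_tendsto_of_le_of_le tendsto_const_nhds
      (ENNReal.tendsto_tsum_compl_atTop_zero hfin) (fun _ => zero_le) fun s => ?_
    refine (measure_mono ?_).trans (measure_iUnion_le fun i : {i // i ∉ s} => f i)
    rintro ω (⟨h1, h2⟩ | ⟨h1, h2⟩)
    · simp only [Set.mem_iUnion] at h1 h2
      obtain ⟨i, -, hi⟩ := h1
      exact absurd ⟨i, hi⟩ h2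
    · simp only [Set.mem_iUnion, not_exists] at h1 h2 ⊢
      obtain ⟨i, hi⟩ := h1
      exact ⟨⟨i, fun his => h2 i his hi⟩, hi⟩
  have := (φ.continuous.tendsto _).comp (tendsto_indicatorConstLp_set (c := (1 : ℝ))
    (hs := MeasurableSet.iUnion hf) (hμs := measure_ne_top μ _)
    (ht := hmeas) (hμt := fun s => measure_ne_top μ _) hp htail)
  rw [HasSum, hI _ (MeasurableSet.iUnion hf)]
  simp only [SummationFilter.unconditional_filter, hsum]
  exact this

/-- The function that represents a continuous linear functional on `L^p` on indicators. -/
theorem exists_density_of_strongDual [Fact (1 ≤ p)] [IsFiniteMeasure μ] (hp : p ≠ ∞)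
    (φ : StrongDual ℝ (Lp ℝ p μ)) : ∃ g : Ω → ℝ, Measurable g ∧ Integrable g μ ∧
      ∀ A (hA : MeasurableSet A),
        φ (indicatorConstLp p hA (measure_ne_top μ A) 1) = ∫ ω in A, g ω ∂μ := by
  obtain ⟨ν, hν⟩ := exists_signedMeasure_of_strongDual hp φ
  have hac : ν ≪ᵥ μ.toENNRealVectorMeasure := by
    refine VectorMeasure.AbsolutelyContinuous.mk fun A hA h0 => ?_
    rw [Measure.toENNRealVectorMeasure_apply_measurable hA] at h0
    have : indicatorConstLp p hA (measure_ne_top μ A) (1 : ℝ) = 0 := by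
      rw [← norm_le_zero_iff]
      refine norm_indicatorConstLp_le.trans ?_
      have hp0 : p.toReal ≠ 0 :=
        (ENNReal.toReal_pos (zero_lt_one.trans_le Fact.out).ne' hp).ne'
      simp [measureReal_def, h0, hp0]
    rw [hν A hA, this, map_zero]
  have h := SignedMeasure.withDensityᵥ_rnDeriv_eq ν μ hac
  refine ⟨ν.rnDeriv μ, SignedMeasure.measurable_rnDeriv _ _, SignedMeasure.integrable_rnDeriv _ _,
    fun A hA => ?_⟩
  rw [← hν A hA, ← withDensityᵥ_apply (SignedMeasure.integrable_rnDeriv _ _) hA, h]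

/-- The converse of Hölder's inequality: `L^p` norms `L^q`. For `q < ∞` the extremal element is
`sign Q * |Q| ^ (q - 1)`; for `q = ∞` the indicators suffice. -/
theorem norm_le_of_pairing_le [Fact (1 ≤ p)] [Fact (1 ≤ q)] [ENNReal.HolderConjugate p q]
    [IsFiniteMeasure μ] (hp : p ≠ ∞) (Q : Lp ℝ q μ) {C : ℝ} (hC : 0 ≤ C)
    (h : ∀ X : Lp ℝ p μ, |pairing X Q| ≤ C * ‖X‖) : ‖Q‖ ≤ C := by
  by_cases hq : q = ∞
  · subst hq
    obtain rfl : p = 1 := by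
      have := ENNReal.HolderConjugate.conjExponent_eq (p := ∞) (q := p)
      simpa [ENNReal.conjExponent] using this.symm
    have hQ : Integrable Q μ := (Lp.memLp Q).integrable le_top
    have hA : ∀ A, MeasurableSet A → |∫ ω in A, Q ω ∂μ| ≤ ∫ ω in A, C ∂μ := by
      intro A hA
      rw [← pairing_indicatorConstLp (p := 1) hA (measure_ne_top μ A)]
      refine (h _).trans ?_
      rw [norm_indicatorConstLp one_ne_zero ENNReal.one_ne_top]
      simp [mul_comm]
    have h1 : Q ≤ᵐ[μ] fun _ => C := ae_le_of_forall_setIntegral_le hQ (integrable_const C)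
      fun A hm _ => (abs_le.1 (hA A hm)).2
    have h2 : (fun _ => -C) ≤ᵐ[μ] Q := ae_le_of_forall_setIntegral_le (integrable_const _) hQ
      fun A hm _ => by
        rw [integral_neg]
        exact (abs_le.1 (hA A hm)).1
    have h3 : ∀ᵐ ω ∂μ, ‖Q ω‖ ≤ C := by
      filter_upwards [h1, h2] with ω a b
      exact abs_le.2 ⟨b, a⟩
    rw [Lp.norm_def]
    refine ENNReal.toReal_le_of_le_ofReal hC ?_
    simpa using eLpNorm_le_of_ae_bound (p := ∞) h3
  · have hc := ENNReal.HolderConjugate.toReal_of_ne_top (p := p) (q := q) hp hq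
    set s : ℝ := q.toReal with hs
    have hs1 : 0 < s - 1 := hc.symm.sub_one_pos
    have hpq : p * ENNReal.ofReal (s - 1) = q := by
      rw [← ENNReal.ofReal_toReal hp, ← ENNReal.ofReal_mul ENNReal.toReal_nonneg, mul_comm,
        hc.symm.sub_one_mul_conj, hs, ENNReal.ofReal_toReal hq]
    have hQm := Lp.aestronglyMeasurable Q
    let f : Ω → ℝ := fun ω => SignType.sign (Q ω) * ‖Q ω‖ ^ (s - 1)
    have hfm : AEStronglyMeasurable f μ := by
      have hsg : Measurable fun x : ℝ => ((SignType.sign x : SignType) : ℝ) := by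
        simp only [sign_apply, apply_ite (SignType.cast : SignType → ℝ)]
        exact Measurable.ite measurableSet_Ioi measurable_const
          (Measurable.ite measurableSet_Iio measurable_const measurable_const)
      exact ((hsg.comp_aemeasurable hQm.aemeasurable).mul
        (hQm.norm.aemeasurable.pow_const _)).aestronglyMeasurable
    have hfn : ∀ ω, ‖f ω‖ = ‖‖Q ω‖ ^ (s - 1)‖ := by
      intro ω
      rcases lt_trichotomy (Q ω) 0 with h0 | h0 | h0
      · simp [f, h0]
      · simp [f, h0, hs1.ne']
      · simp [f, h0]
    have hfe : eLpNorm f p μ = eLpNorm Q q μ ^ (s - 1) := by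
      rw [eLpNorm_congr_norm_ae (Filter.Eventually.of_forall hfn), eLpNorm_norm_rpow _ hs1, hpq]
    have hf : MemLp f p μ := ⟨hfm, by
      rw [hfe]; exact ENNReal.rpow_lt_top_of_nonneg hs1.le (Lp.eLpNorm_ne_top Q)⟩
    have hnorm : ‖hf.toLp f‖ = ‖Q‖ ^ (s - 1) := by
      rw [Lp.norm_toLp, hfe, Lp.norm_def, ENNReal.toReal_rpow]
    have hpair : pairing (hf.toLp f) Q = ‖Q‖ ^ s := by
      have h1 : pairing (hf.toLp f) Q = ∫ ω, ‖Q ω‖ ^ s ∂μ := by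
        refine integral_congr_ae ?_
        filter_upwards [hf.coeFn_toLp] with ω hω
        rw [hω]
        have h2 : (SignType.sign (Q ω) : ℝ) * Q ω = ‖Q ω‖ := sign_mul_self _
        calc f ω * Q ω = ‖Q ω‖ ^ (s - 1) * ((SignType.sign (Q ω) : ℝ) * Q ω) := by
              simp only [f]; ring
          _ = ‖Q ω‖ ^ (s - 1) * ‖Q ω‖ := by rw [h2]
          _ = ‖Q ω‖ ^ s := by
              have h3 := Real.rpow_add_of_nonneg (norm_nonneg (Q ω)) hs1.le zero_le_one
              rw [Real.rpow_one, sub_add_cancel] at h3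
              exact h3.symm
      have hs0 : s ≠ 0 := by linarith
      have hi : 0 ≤ ∫ ω, ‖Q ω‖ ^ s ∂μ := integral_nonneg fun ω => by positivity
      rw [h1, Lp.norm_def, (Lp.memLp Q).eLpNorm_eq_integral_rpow_norm
        (zero_lt_one.trans_le Fact.out).ne' hq, ENNReal.toReal_ofReal (by positivity),
        ← hs, Real.rpow_inv_rpow hi hs0]
    have hkey := (le_abs_self _).trans (h (hf.toLp f))
    rw [hpair, hnorm] at hkey
    rcases (norm_nonneg Q).eq_or_lt with h0 | h0
    · rw [← h0]; exact hC
    · have h3 := Real.rpow_add h0 1 (s - 1)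
      rw [Real.rpow_one, add_sub_cancel] at h3
      rw [h3] at hkey
      exact le_of_mul_le_mul_right hkey (by positivity)

/-- Riesz representation: for `p < ∞` every continuous linear functional on `L^p` is the pairing
with an element of `L^q`. The truncations of the density of `A ↦ φ(1_A)` represent the functionals
`X ↦ φ(1_B X)`, so their `L^q` norms are bounded by `‖φ‖`. -/
theorem exists_eq_pairing [Fact (1 ≤ p)] [Fact (1 ≤ q)] [ENNReal.HolderConjugate p q]
    [IsFiniteMeasure μ] (hp : p ≠ ∞) (φ : StrongDual ℝ (Lp ℝ p μ)) :
    ∃ Q : Lp ℝ q μ, ∀ X, φ X = pairing X Q := by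
  obtain ⟨g, hgm, hgi, hg⟩ := exists_density_of_strongDual hp φ
  have represent : ∀ (ψ : StrongDual ℝ (Lp ℝ p μ)) (f : Ω → ℝ) (hf : MemLp f q μ),
      (∀ A (hA : MeasurableSet A),
        ψ (indicatorConstLp p hA (measure_ne_top μ A) 1) = ∫ ω in A, f ω ∂μ) →
      ∀ X, ψ X = pairing X (hf.toLp f) := by
    intro ψ f hf h X
    have : ψ = (pairingCLM p q μ).flip (hf.toLp f) := by
      refine Lp_strongDual_ext hp fun A hA => ?_
      rw [h A hA, ContinuousLinearMap.flip_apply, pairingCLM_apply, pairing_indicatorConstLp]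
      exact setIntegral_congr_ae hA (hf.coeFn_toLp.mono fun ω hω _ => hω.symm)
    rw [this, ContinuousLinearMap.flip_apply, pairingCLM_apply]
  let B : ℕ → Set Ω := fun n => {ω | |g ω| ≤ n}
  have hB : ∀ n, MeasurableSet (B n) := fun n =>
    measurableSet_le (continuous_abs.measurable.comp hgm) measurable_const
  have hmem : ∀ n, MemLp ((B n).indicator g) q μ := by
    intro n
    refine MemLp.of_bound (hgm.indicator (hB n)).aestronglyMeasurable n
      (Filter.Eventually.of_forall fun ω => ?_)
    by_cases hω : ω ∈ B n
    · rw [Set.indicator_of_mem hω]; exact hω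
    · simp [hω]
  have hbound : ∀ n, eLpNorm ((B n).indicator g) q μ ≤ ENNReal.ofReal ‖φ‖ := by
    intro n
    have hle : ‖(hmem n).toLp‖ ≤ ‖φ‖ := by
      refine norm_le_of_pairing_le hp _ (norm_nonneg φ) fun X => ?_
      let T : Lp ℝ p μ →L[ℝ] Lp ℝ p μ := (ContinuousLinearMap.mul ℝ ℝ).holderL μ ∞ p p
        (indicatorConstLp ∞ (hB n) (measure_ne_top μ _) 1)
      have hT : ∀ Y, T Y =ᵐ[μ] (B n).indicator Y := by
        intro Y
        have h1 := (ContinuousLinearMap.mul ℝ ℝ).coeFn_holder (r := p)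
          (indicatorConstLp ∞ (hB n) (measure_ne_top μ _) 1) Y
        filter_upwards [h1, indicatorConstLp_coeFn (p := ∞) (hs := hB n)
          (hμs := measure_ne_top μ _) (c := (1 : ℝ))] with ω h1 h2
        rw [show T Y ω = _ from h1, h2]
        by_cases hω : ω ∈ B n <;> simp [hω]
      have hTnorm : ‖T X‖ ≤ ‖X‖ := by
        refine Lp.norm_le_norm_of_ae_le ?_
        filter_upwards [hT X] with ω hω
        rw [hω]
        exact norm_indicator_le_norm_self _ _
      have hrep := represent (φ.comp T) _ (hmem n) (fun A hA => by
        have : T (indicatorConstLp p hA (measure_ne_top μ A) 1) =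
            indicatorConstLp p (hA.inter (hB n)) (measure_ne_top μ _) 1 := by
          ext1
          filter_upwards [hT (indicatorConstLp p hA (measure_ne_top μ A) 1),
            indicatorConstLp_coeFn (p := p) (hs := hA)
              (hμs := measure_ne_top μ _) (c := (1 : ℝ)),
            indicatorConstLp_coeFn (p := p) (hs := hA.inter (hB n))
              (hμs := measure_ne_top μ _) (c := (1 : ℝ))] with ω h1 h2 h3
          rw [h1, h3]
          by_cases hω : ω ∈ B n
          · rw [Set.indicator_of_mem hω, h2]
            by_cases hω' : ω ∈ A <;> simp [hω, hω']
          · simp [hω]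
        rw [ContinuousLinearMap.comp_apply, this, hg, setIntegral_indicator (hB n)]) X
      rw [← hrep, ContinuousLinearMap.comp_apply, ← Real.norm_eq_abs]
      exact (φ.le_opNorm _).trans (by gcongr)
    rw [Lp.norm_toLp] at hle
    exact (ENNReal.le_ofReal_iff_toReal_le (hmem n).eLpNorm_ne_top (norm_nonneg _)).2 hle
  have hlim : ∀ ω, Filter.Tendsto (fun n => (B n).indicator g ω) Filter.atTop (𝓝 (g ω)) := by
    intro ω
    refine tendsto_const_nhds.congr' ?_
    filter_upwards [Filter.eventually_ge_atTop ⌈|g ω|⌉₊] with n hn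
    have : ω ∈ B n := (Nat.le_ceil |g ω|).trans (Nat.cast_le.2 hn)
    simp [this]
  have hgq : MemLp g q μ := by
    refine ⟨hgm.aestronglyMeasurable, lt_of_le_of_lt ?_ (ENNReal.ofReal_lt_top (r := ‖φ‖))⟩
    refine (Lp.eLpNorm_lim_le_liminf_eLpNorm (fun n => (hmem n).aestronglyMeasurable) g
      (Filter.Eventually.of_forall hlim)).trans ?_
    exact (Filter.liminf_le_liminf (Filter.Eventually.of_forall hbound)).trans (by simp)
  exact ⟨hgq.toLp, represent φ g hgq hg⟩

/-- The pairing separates the points of `L^p`. -/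
theorem eq_zero_of_pairing_eq_zero [Fact (1 ≤ p)] [Fact (1 ≤ q)] [ENNReal.HolderConjugate p q]
    [IsFiniteMeasure μ] {X : Lp ℝ p μ} (h : ∀ Q : Lp ℝ q μ, pairing X Q = 0) : X = 0 := by
  have hX : Integrable X μ := (Lp.memLp X).integrable Fact.out
  have h0 : X =ᵐ[μ] 0 := hX.ae_eq_zero_of_forall_setIntegral_eq_zero fun A hA _ => by
    rw [← pairing_indicatorConstLp (p := q) hA (measure_ne_top μ A), pairing_comm, h]
  exact (Lp.eq_zero_iff_ae_eq_zero).2 h0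

/-- The continuous linear functionals on `L^q`, with its topology as the dual of `L^p`, are the
pairings with the elements of `L^p`: by Riesz representation on `L^q` if `q < ∞`, and because the
weak-* topology has no other continuous functionals if `q = ∞`. -/
theorem isCompatibleTopology_dualTopology [Fact (1 ≤ p)] [Fact (1 ≤ q)]
    [ENNReal.HolderConjugate p q] [IsFiniteMeasure μ] :
    IsCompatibleTopology (dualTopology p q μ) (pairingₗ p q μ) := by
  by_cases hq : q = ∞
  · have hτ : dualTopology p q μ =
        (WeakBilin.instTopologicalSpace (pairingₗ p q μ).flip : TopologicalSpace (Lp ℝ q μ)) := by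
      rw [dualTopology, if_pos hq]; rfl
    rw [hτ]
    refine ⟨WeakBilin.instIsTopologicalAddGroup (pairingₗ p q μ).flip,
      WeakBilin.instContinuousSMul (pairingₗ p q μ).flip,
      WeakBilin.locallyConvexSpace (B := (pairingₗ p q μ).flip), fun l => ⟨fun hl => ?_, ?_⟩⟩
    · obtain ⟨X, hX⟩ := LinearMap.dualEmbedding_surjective (pairingₗ p q μ).flip
        (⟨l, hl⟩ : StrongDual ℝ (WeakBilin (pairingₗ p q μ).flip))
      exact ⟨X, LinearMap.ext fun Q => (DFunLike.congr_fun hX Q).symm⟩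
    · rintro ⟨X, rfl⟩
      exact WeakBilin.eval_continuous (pairingₗ p q μ).flip X
  · have hτ : dualTopology p q μ = (inferInstance : TopologicalSpace (Lp ℝ q μ)) := by
      rw [dualTopology, if_neg hq]
    rw [hτ]
    refine ⟨inferInstance, inferInstance, inferInstance, fun l => ⟨fun hl => ?_, ?_⟩⟩
    · obtain ⟨X, hX⟩ := exists_eq_pairing (p := q) (q := p) hq ⟨l, hl⟩
      exact ⟨X, LinearMap.ext fun Q => (hX Q).trans (pairing_comm _ _)⟩
    · rintro ⟨X, rfl⟩
      have : ⇑(pairingₗ p q μ X) = pairingCLM p q μ X :=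
        funext fun Q => (pairingCLM_apply X Q).symm
      rw [this]
      exact (pairingCLM p q μ X).continuous

end LpDual

/-! ### Averse functionals in a dual pair -/

section Averse

variable {V W : Type*} [AddCommGroup V] [Module ℝ V] [AddCommGroup W] [Module ℝ W]

/-- The functional `F` dominates the linear functional `⟨·, a⟩`, agrees with it on the subspace
`K`, and exceeds it somewhere on every ray that is not in `K`. The four kinds of subregular measures
are the cases `a = 0` and `a = 1`, with `K` trivial or the space of constants. -/
structure IsAverse (B : V →ₗ[ℝ] W →ₗ[ℝ] ℝ) (F : V → EReal) (K : Submodule ℝ V) (a : W) :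
    Prop where
  eq_on : ∀ X ∈ K, F X = (B X a : EReal)
  le : ∀ X, (B X a : EReal) ≤ F X
  averse : ∀ X, X ∉ K → ∃ t : ℝ, 0 < t ∧ (B (t • X) a : EReal) < F (t • X)

/-- `F` is the supremum of its affine minorants with slope in `W`. -/
def IsSupOfAffineMinorants (B : V →ₗ[ℝ] W →ₗ[ℝ] ℝ) (F : V → EReal) : Prop :=
  ∀ (X : V) (r : ℝ), (r : EReal) < F X → ∃ Q b, IsAffineMinorant B F Q b ∧ r < B X Q - b

variable {B : V →ₗ[ℝ] W →ₗ[ℝ] ℝ} {F : V → EReal} {K : Submodule ℝ V} {a : W}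

/-- `F` is averse outside `K` with respect to `a` exactly if all affine minorants of `F` have
non-negative offset, `⟨·, a⟩` is a minorant, all slopes agree with `a` on `K`, and the slopes
distinguish every `X ∉ K` from `a`. -/
theorem isAverse_iff_minorants (hF : IsSupOfAffineMinorants B F) (K : Submodule ℝ V) (a : W) :
    IsAverse B F K a ↔
    ((∀ Q b, IsAffineMinorant B F Q b → 0 ≤ b) ∧ IsAffineMinorant B F a 0 ∧
      (∀ Q b, IsAffineMinorant B F Q b → ∀ X ∈ K, B X Q = B X a) ∧
      ∀ X, X ∉ K → ∃ Q b, IsAffineMinorant B F Q b ∧ B X a < B X Q) := by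
  constructor
  · rintro ⟨hK, hle, hav⟩
    have hnn : ∀ Q b, IsAffineMinorant B F Q b → 0 ≤ b := by
      intro Q b hQ
      have h := hQ 0
      rw [hK 0 K.zero_mem] at h
      norm_cast at h
      simpa using h
    refine ⟨hnn, fun X => by simpa using hle X, ?_, ?_⟩
    · intro Q b hQ X hX
      have key : ∀ t : ℝ, t * (B X Q - B X a) ≤ b := by
        intro t
        have h := hQ (t • X)
        rw [hK _ (K.smul_mem t hX)] at h
        norm_cast at h
        simp only [map_smul, LinearMap.smul_apply, smul_eq_mul] at h
        linarith
      -- The slope of a bounded linear function of `t` vanishes.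
      by_contra hne
      have h := key ((b + 1) / (B X Q - B X a))
      rw [div_mul_cancel₀ _ (sub_ne_zero.2 hne)] at h
      linarith
    · intro X hX
      obtain ⟨t, ht, hlt⟩ := hav X hX
      obtain ⟨Q, b, hQ, hb⟩ := hF _ _ hlt
      refine ⟨Q, b, hQ, ?_⟩
      have := hnn Q b hQ
      simp only [map_smul, LinearMap.smul_apply, smul_eq_mul] at hb
      exact lt_of_mul_lt_mul_left (by linarith) ht.le
  · rintro ⟨hnn, ha, hK, hav⟩
    have hle : ∀ X, (B X a : EReal) ≤ F X := fun X => by simpa using ha X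
    refine ⟨fun X hX => le_antisymm ?_ (hle X), hle, fun X hX => ?_⟩
    · by_contra! hlt
      obtain ⟨Q, b, hQ, hb⟩ := hF _ _ hlt
      have := hnn Q b hQ
      rw [hK Q b hQ X hX] at hb
      linarith
    · obtain ⟨Q, b, hQ, hlt⟩ := hav X hX
      have hpos : 0 < B X Q - B X a := by linarith
      have hb := hnn Q b hQ
      -- This multiple of `X` makes `⟨·, Q - a⟩` equal to `b + 1`.
      refine ⟨(b + 1) / (B X Q - B X a), by positivity, lt_of_lt_of_le ?_ (hQ _)⟩
      have : (b + 1) / (B X Q - B X a) * (B X Q - B X a) = b + 1 :=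
        div_mul_cancel₀ _ hpos.ne'
      norm_cast
      simp only [map_smul, LinearMap.smul_apply, smul_eq_mul]
      linarith

theorem IsSupOfAffineMinorants.exists_linear (hF : IsSupOfAffineMinorants B F)
    (hom : ∀ X : V, ∀ t : ℝ, 0 ≤ t → F (t • X) = (t : EReal) * F X) {X : V} {r : ℝ}
    (hr : (r : EReal) < F X) : ∃ Q, IsAffineMinorant B F Q 0 ∧ r < B X Q := by
  obtain ⟨Q, b, hQ, hb⟩ := hF X r hr
  obtain ⟨hb0, hQ0⟩ := hQ.of_posHomogeneous hom
  exact ⟨Q, hQ0, by linarith⟩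

/-- For a positively homogeneous functional, aversity is a property of its linear minorants. -/
theorem isAverse_iff_linearMinorants (hF : IsSupOfAffineMinorants B F)
    (hom : ∀ X : V, ∀ t : ℝ, 0 ≤ t → F (t • X) = (t : EReal) * F X) {H : Set W}
    (hH : ∀ w, w ∈ H ↔ ∀ X ∈ K, B X w = B X a) :
    IsAverse B F K a ↔ a ∈ {Q | IsAffineMinorant B F Q 0} ∧ {Q | IsAffineMinorant B F Q 0} ⊆ H ∧
      ∀ X, X ∉ K → ∃ Q ∈ {Q | IsAffineMinorant B F Q 0}, B X a < B X Q := by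
  rw [isAverse_iff_minorants hF]
  constructor
  · rintro ⟨-, ha, hK, hav⟩
    refine ⟨ha, fun Q hQ => (hH Q).2 (hK Q 0 hQ), fun X hX => ?_⟩
    obtain ⟨Q, b, hQ, hlt⟩ := hav X hX
    exact ⟨Q, (hQ.of_posHomogeneous hom).2, hlt⟩
  · rintro ⟨ha, hK, hav⟩
    refine ⟨fun Q b hQ => (hQ.of_posHomogeneous hom).1, ha,
      fun Q b hQ => (hH Q).1 (hK (hQ.of_posHomogeneous hom).2), fun X hX => ?_⟩
    obtain ⟨Q, hQ, hlt⟩ := hav X hX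
    exact ⟨Q, 0, hQ, hlt⟩

theorem isAverse_iff_mem_quasiInteriorIn {τ : TopologicalSpace W} (hτ : IsCompatibleTopology τ B)
    (hF : IsSupOfAffineMinorants B F)
    (hom : ∀ X : V, ∀ t : ℝ, 0 ≤ t → F (t • X) = (t : EReal) * F X) {H : Set W}
    (hH : ∀ w, w ∈ H ↔ ∀ X ∈ K, B X w = B X a)
    (hK : ∀ X, (∀ w, w + a ∈ H → B X w = 0) → X ∈ K) :
    IsAverse B F K a ↔ IsClosed[τ] {Q | IsAffineMinorant B F Q 0} ∧
      Convex ℝ {Q | IsAffineMinorant B F Q 0} ∧ {Q | IsAffineMinorant B F Q 0} ⊆ H ∧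
      a ∈ quasiInteriorIn τ H {Q | IsAffineMinorant B F Q 0} := by
  have hC := convex_linearMinorants B F
  rw [isAverse_iff_linearMinorants hF hom hH]
  constructor
  · rintro ⟨ha, hCH, hav⟩
    exact ⟨hτ.isClosed_linearMinorants F, hC, hCH,
      (mem_quasiInteriorIn_iff hτ K hH hK hC hCH ha).2 hav⟩
  · rintro ⟨-, -, hCH, ha⟩
    exact ⟨ha.1, hCH, (mem_quasiInteriorIn_iff hτ K hH hK hC hCH ha.1).1 ha⟩

theorem isAverse_iff_hyperplanesCutExcept {τ : TopologicalSpace W} (hτ : IsCompatibleTopology τ B)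
    (hF : IsSupOfAffineMinorants B F)
    (hom : ∀ X : V, ∀ t : ℝ, 0 ≤ t → F (t • X) = (t : EReal) * F X) {H : Set W}
    (hH : ∀ w, w ∈ H ↔ ∀ X ∈ K, B X w = B X a)
    (hK : ∀ X, (∀ w, w + a ∈ H → B X w = 0) → X ∈ K)
    (hdim : ∀ X ∈ K, B X = 0 ∨ {w | B X w = B X a} = H) :
    IsAverse B F K a ↔ {Q | IsAffineMinorant B F Q 0} ⊆ H ∧
      a ∈ {Q | IsAffineMinorant B F Q 0} ∧
      HyperplanesCutExcept τ H {Q | IsAffineMinorant B F Q 0} a := by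
  have hK' : ∀ X, X ∈ K ↔ B X = 0 ∨ {w | B X w = B X a} = H := by
    refine fun X => ⟨hdim X, ?_⟩
    rintro (h0 | rfl)
    · exact hK X fun w _ => by rw [h0, LinearMap.zero_apply]
    · exact hK X fun w hw => by simpa using hw
  rw [isAverse_iff_linearMinorants hF hom hH, hyperplanesCutExcept_iff hτ K hK']
  exact and_left_comm

/-- The linear minorants of a closed positively homogeneous functional form the only closed convex
set of which it is the support function. -/
theorem supportFunction_iff_eq_linearMinorants {τ : TopologicalSpace W}
    (hτ : IsCompatibleTopology τ B) (hF : IsSupOfAffineMinorants B F)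
    (hom : ∀ X : V, ∀ t : ℝ, 0 ≤ t → F (t • X) = (t : EReal) * F X) (C : Set W) :
    (IsClosed[τ] C ∧ Convex ℝ C ∧ ∀ X, F X = ⨆ Q ∈ C, (B X Q : EReal)) ↔
      C = {Q | IsAffineMinorant B F Q 0} := by
  constructor
  · rintro ⟨hcl, hconv, hsup⟩
    refine Set.Subset.antisymm (fun Q hQ X => ?_) fun Q hQ => ?_
    · rw [sub_zero, hsup]
      exact le_iSup₂ (f := fun Q (_ : Q ∈ C) => (B X Q : EReal)) Q hQ
    · by_contra hn
      obtain ⟨X, u, hX, hu⟩ := hτ.exists_separating hconv hcl hn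
      have h1 : F X ≤ (u : EReal) := by
        rw [hsup]
        exact iSup₂_le fun z hz => by exact_mod_cast (hX z hz).le
      have h2 := (hQ X).trans h1
      rw [sub_zero] at h2
      exact absurd (EReal.coe_le_coe_iff.1 h2) (not_le.2 hu)
  · rintro rfl
    refine ⟨hτ.isClosed_linearMinorants F, convex_linearMinorants B F, fun X => ?_⟩
    refine le_antisymm ?_ (iSup₂_le fun Q hQ => by simpa using hQ X)
    by_contra! hlt
    obtain ⟨r, hr1, hr2⟩ := EReal.lt_iff_exists_real_btwn.1 hlt
    obtain ⟨Q, hQ, hrQ⟩ := hF.exists_linear hom hr2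
    have h1 : (B X Q : EReal) ≤ ⨆ Q ∈ {Q | IsAffineMinorant B F Q 0}, (B X Q : EReal) :=
      le_iSup₂ (f := fun Q (_ : Q ∈ {Q | IsAffineMinorant B F Q 0}) => (B X Q : EReal)) Q hQ
    exact absurd (h1.trans_lt hr1) (not_lt.2 (by exact_mod_cast hrQ.le))

end Averse

/-! ### Conjugates and envelopes of functionals on `L^p` -/

section Conjugate

variable {Ω : Type*} [MeasurableSpace Ω] {μ : Measure Ω} {p q : ℝ≥0∞}
  [Fact (1 ≤ p)] [Fact (1 ≤ q)] [ENNReal.HolderConjugate p q] {F : Lp ℝ p μ → EReal}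

/-- The Fenchel–Moreau theorem on `L^p`, with slopes in `L^q`. -/
theorem IsClosedProperConvex.isSupOfAffineMinorants [IsFiniteMeasure μ] (hp : p ≠ ∞)
    (hF : IsClosedProperConvex F) : IsSupOfAffineMinorants (pairingₗ p q μ) F := by
  intro X r hr
  obtain ⟨l, b, hlt, hle⟩ := exists_affine_minorant hF.ne_bot hF.convex hF.closed hF.proper hr
  obtain ⟨Q, hQ⟩ := exists_eq_pairing (q := q) hp l
  refine ⟨Q, b, fun Z => ?_, ?_⟩
  · rw [pairingₗ_apply, ← hQ]; exact hle Z
  · rw [pairingₗ_apply, ← hQ]; exact hlt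

theorem conjugate_le_iff (hbot : ∀ X, F X ≠ ⊥) {Q : Lp ℝ q μ} {b : ℝ} :
    conjugate F Q ≤ b ↔ IsAffineMinorant (pairingₗ p q μ) F Q b := by
  rw [isAffineMinorant_iff_iSup_le hbot, conjugate]
  simp only [pairingₗ_apply]

theorem mem_effDom_conjugate_iff (hbot : ∀ X, F X ≠ ⊥) {Q : Lp ℝ q μ} :
    Q ∈ effDom (conjugate F) ↔ ∃ b, IsAffineMinorant (pairingₗ p q μ) F Q b := by
  simp only [← conjugate_le_iff hbot]
  constructor
  · intro h
    obtain ⟨b, hb, -⟩ := EReal.lt_iff_exists_real_btwn.1 h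
    exact ⟨b, hb.le⟩
  · rintro ⟨b, hb⟩
    exact hb.trans_lt (EReal.coe_lt_top b)

theorem riskEnvelope_eq_linearMinorants :
    riskEnvelope q F = {Q | IsAffineMinorant (pairingₗ p q μ) F Q 0} := by
  simp only [riskEnvelope, IsAffineMinorant, pairingₗ_apply, sub_zero]

theorem riskEnvelope_eq_effDom_conjugate (hbot : ∀ X, F X ≠ ⊥) (hom : IsPosHomogeneous F) :
    riskEnvelope q F = effDom (conjugate F) := by
  ext Q
  rw [riskEnvelope_eq_linearMinorants, mem_effDom_conjugate_iff hbot]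
  exact ⟨fun h => ⟨0, h⟩, fun ⟨_, h⟩ => (h.of_posHomogeneous hom).2⟩

/-- Aversity in terms of the conjugate, with `H = a + Kᗮ`. -/
theorem isAverse_iff_conjugate (hbot : ∀ X, F X ≠ ⊥)
    (hF : IsSupOfAffineMinorants (pairingₗ p q μ) F) {K : Submodule ℝ (Lp ℝ p μ)} {a : Lp ℝ q μ}
    {H : Set (Lp ℝ q μ)} (hH : ∀ w, w ∈ H ↔ ∀ X ∈ K, pairingₗ p q μ X w = pairingₗ p q μ X a) :
    IsAverse (pairingₗ p q μ) F K a ↔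
      (∀ Q : Lp ℝ q μ, conjugate F a ≤ conjugate F Q) ∧ conjugate F a = 0 ∧
      (∀ Q ∈ (effDom (conjugate F) : Set (Lp ℝ q μ)), Q ∈ H) ∧
      ∀ X, X ∉ K → ∃ Q ∈ (effDom (conjugate F) : Set (Lp ℝ q μ)), pairing X a < pairing X Q := by
  rw [isAverse_iff_minorants hF]
  simp only [hH]
  constructor
  · rintro ⟨hnn, ha, hK, hav⟩
    have hconj : ∀ Q : Lp ℝ q μ, 0 ≤ conjugate F Q := by
      intro Q
      by_contra! hlt
      obtain ⟨b, hb, hb0⟩ := EReal.lt_iff_exists_real_btwn.1 hlt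
      have := hnn Q b ((conjugate_le_iff hbot).1 hb.le)
      exact absurd hb0 (not_lt.2 (by exact_mod_cast this))
    have ha' : conjugate F a ≤ 0 := (conjugate_le_iff hbot).2 ha
    refine ⟨fun Q => ha'.trans (hconj Q), le_antisymm ha' (hconj a), fun Q hQ => ?_,
      fun X hX => ?_⟩
    · obtain ⟨b, hb⟩ := (mem_effDom_conjugate_iff hbot).1 hQ
      exact hK Q b hb
    · obtain ⟨Q, b, hQ, hlt⟩ := hav X hX
      exact ⟨Q, (mem_effDom_conjugate_iff hbot).2 ⟨b, hQ⟩, hlt⟩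
  · rintro ⟨hmin, ha, hK, hav⟩
    refine ⟨fun Q b hQ => ?_, (conjugate_le_iff hbot).1 ha.le,
      fun Q b hQ => hK Q ((mem_effDom_conjugate_iff hbot).2 ⟨b, hQ⟩), fun X hX => ?_⟩
    · have := (hmin Q).trans ((conjugate_le_iff hbot).2 hQ)
      rw [ha] at this
      exact_mod_cast this
    · obtain ⟨Q, hQ, hlt⟩ := hav X hX
      obtain ⟨b, hb⟩ := (mem_effDom_conjugate_iff hbot).1 hQ
      exact ⟨Q, b, hb, hlt⟩

end Conjugate

/-! ### The four kinds of subregular measures -/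

section Subregular

variable {Ω : Type*} [MeasurableSpace Ω] {μ : Measure Ω} {p q : ℝ≥0∞}

theorem pairing_one_right [IsFiniteMeasure μ] (X : Lp ℝ p μ) :
    pairing X (Lp.const q μ 1) = expect X := by
  rw [pairing_const_right, one_mul]

theorem expect_const [IsProbabilityMeasure μ] (c : ℝ) : expect (Lp.const p μ c) = c := by
  rw [expect, integral_congr_ae (Lp.coeFn_const p μ c)]
  simp

theorem expect_zero : expect (0 : Lp ℝ p μ) = 0 := by
  rw [expect, integral_congr_ae (Lp.coeFn_zero ℝ p μ)]
  simp

/-- The constants in `L^p`. -/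
noncomputable def constants (p : ℝ≥0∞) (μ : Measure Ω) [IsFiniteMeasure μ] :
    Submodule ℝ (Lp ℝ p μ) := LinearMap.range (Lp.constₗ p μ ℝ)

theorem mem_constants_iff [IsFiniteMeasure μ] {X : Lp ℝ p μ} :
    X ∈ constants p μ ↔ IsConstant X := by
  simp only [constants, LinearMap.mem_range, IsConstant, eq_comm (a := X)]
  rfl

variable [Fact (1 ≤ p)] [Fact (1 ≤ q)] [ENNReal.HolderConjugate p q] {F : Lp ℝ p μ → EReal}

theorem pairing_zero_right (X : Lp ℝ p μ) : pairing X (0 : Lp ℝ q μ) = 0 := by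
  rw [← pairingₗ_apply, map_zero]

theorem isSubregularError_iff_isAverse (hF : IsClosedConvex F) :
    IsSubregularError F ↔ IsAverse (pairingₗ p q μ) F ⊥ 0 := by
  constructor
  · intro h
    refine ⟨?_, fun X => ?_, fun X hX => ?_⟩
    · rintro X rfl
      simpa [pairing_zero_right] using h.map_zero
    · simpa [pairing_zero_right] using h.nonneg X
    · simpa [pairing_zero_right] using h.averse X hX
  · intro h
    refine ⟨hF, ?_, fun X => ?_, fun X hX => ?_⟩
    · simpa [pairing_zero_right] using h.eq_on 0 (Submodule.zero_mem _)
    · simpa [pairing_zero_right] using h.le X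
    · simpa [pairing_zero_right] using h.averse X hX

theorem isSubregularRegret_iff_isAverse [IsFiniteMeasure μ] (hF : IsClosedConvex F) :
    IsSubregularRegret F ↔ IsAverse (pairingₗ p q μ) F ⊥ (Lp.const q μ 1) := by
  constructor
  · intro h
    refine ⟨?_, fun X => ?_, fun X hX => ?_⟩
    · rintro X rfl
      rw [map_zero, LinearMap.zero_apply]
      exact h.map_zero
    · simpa [pairing_one_right] using h.expect_le X
    · simpa only [pairingₗ_apply, pairing_one_right] using h.averse X hX
  · intro h
    refine ⟨hF, ?_, fun X => ?_, fun X hX => ?_⟩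
    · have := h.eq_on 0 (Submodule.zero_mem _)
      rwa [map_zero, LinearMap.zero_apply] at this
    · simpa [pairing_one_right] using h.le X
    · simpa only [pairingₗ_apply, pairing_one_right] using h.averse X hX

theorem isSubregularDeviation_iff_isAverse [IsFiniteMeasure μ] (hF : IsClosedConvex F) :
    IsSubregularDeviation F ↔ IsAverse (pairingₗ p q μ) F (constants p μ) 0 := by
  constructor
  · intro h
    refine ⟨fun X hX => ?_, fun X => ?_, fun X hX => ?_⟩
    · obtain ⟨c, rfl⟩ := mem_constants_iff.1 hX
      simpa [pairing_zero_right] using h.map_const c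
    · simpa [pairing_zero_right] using h.nonneg X
    · simpa [pairing_zero_right] using h.averse X (mt mem_constants_iff.2 hX)
  · intro h
    refine ⟨hF, fun c => ?_, fun X => ?_, fun X hX => ?_⟩
    · simpa [pairing_zero_right] using h.eq_on _ (mem_constants_iff.2 ⟨c, rfl⟩)
    · simpa [pairing_zero_right] using h.le X
    · simpa [pairing_zero_right] using h.averse X (mt mem_constants_iff.1 hX)

theorem isSubregularRisk_iff_isAverse [IsProbabilityMeasure μ] (hF : IsClosedConvex F) :
    IsSubregularRisk F ↔ IsAverse (pairingₗ p q μ) F (constants p μ) (Lp.const q μ 1) := by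
  constructor
  · intro h
    refine ⟨fun X hX => ?_, fun X => ?_, fun X hX => ?_⟩
    · obtain ⟨c, rfl⟩ := mem_constants_iff.1 hX
      rw [pairingₗ_apply, pairing_one_right, expect_const]
      exact h.map_const c
    · simpa [pairing_one_right] using h.expect_le X
    · simpa only [pairingₗ_apply, pairing_one_right] using
        h.averse X (mt mem_constants_iff.2 hX)
  · intro h
    refine ⟨hF, fun c => ?_, fun X => ?_, fun X hX => ?_⟩
    · have := h.eq_on _ (mem_constants_iff.2 ⟨c, rfl⟩)
      rwa [pairingₗ_apply, pairing_one_right, expect_const] at this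
    · simpa [pairing_one_right] using h.le X
    · simpa only [pairingₗ_apply, pairing_one_right] using
        h.averse X (mt mem_constants_iff.1 hX)

/-- The `K = 0`, `H = L^q` counterpart of `mem_constants_of_pairing_eq_zero`. -/
theorem mem_bot_of_pairing_eq_zero [IsFiniteMeasure μ] {X : Lp ℝ p μ} {a : Lp ℝ q μ}
    (h : ∀ w : Lp ℝ q μ, w + a ∈ (Set.univ : Set (Lp ℝ q μ)) → pairingₗ p q μ X w = 0) :
    X ∈ (⊥ : Submodule ℝ (Lp ℝ p μ)) :=
  eq_zero_of_pairing_eq_zero fun Q => h Q (Set.mem_univ _)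

theorem mem_expectHyperplane_iff [IsProbabilityMeasure μ] {a : Lp ℝ q μ} {c : ℝ}
    (ha : expect a = c) (w : Lp ℝ q μ) :
    w ∈ expectHyperplane q μ c ↔
      ∀ X ∈ constants p μ, pairingₗ p q μ X w = pairingₗ p q μ X a := by
  constructor
  · intro hw X hX
    obtain ⟨k, rfl⟩ := mem_constants_iff.1 hX
    rw [pairingₗ_apply, pairingₗ_apply, pairing_const_left, pairing_const_left, ha,
      show _ = c from hw]
  · intro h
    have h1 := h _ (mem_constants_iff.2 ⟨1, rfl⟩)
    rwa [pairingₗ_apply, pairingₗ_apply, pairing_const_left, pairing_const_left, ha, one_mul,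
      one_mul] at h1

/-- If `X` annihilates all `w` with `E[w] = 0`, then `X` is the constant `E[X]`. -/
theorem mem_constants_of_pairing_eq_zero [IsProbabilityMeasure μ] {X : Lp ℝ p μ} {a : Lp ℝ q μ}
    {c : ℝ} (ha : expect a = c)
    (h : ∀ w : Lp ℝ q μ, w + a ∈ expectHyperplane q μ c → pairingₗ p q μ X w = 0) :
    X ∈ constants p μ := by
  refine mem_constants_iff.2 ⟨expect X, sub_eq_zero.1 ?_⟩
  refine eq_zero_of_pairing_eq_zero (q := q) fun Q => ?_
  have hQ : Q - Lp.const q μ (expect Q) + a ∈ expectHyperplane q μ c := by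
    rw [mem_expectHyperplane_iff (p := p) ha]
    intro Y hY
    obtain ⟨k, rfl⟩ := mem_constants_iff.1 hY
    rw [map_add, map_sub, pairingₗ_apply, pairingₗ_apply, pairing_const_left, pairing_const_left,
      expect_const, sub_self, zero_add]
  have h0 := h _ hQ
  rw [map_sub, pairingₗ_apply, pairingₗ_apply, pairing_const_right] at h0
  rw [← pairingₗ_apply, map_sub, LinearMap.sub_apply, pairingₗ_apply, pairingₗ_apply,
    pairing_const_left]
  linarith

/-- A non-zero constant defines the hyperplane of fixed expectation. -/
theorem pairing_const_hyperplane [IsFiniteMeasure μ] {a : Lp ℝ q μ} {c : ℝ}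
    (ha : expect a = c) (X : Lp ℝ p μ) (hX : X ∈ constants p μ) :
    pairingₗ p q μ X = 0 ∨
      {w | pairingₗ p q μ X w = pairingₗ p q μ X a} = expectHyperplane q μ c := by
  obtain ⟨k, rfl⟩ := mem_constants_iff.1 hX
  rcases eq_or_ne k 0 with rfl | hk
  · left; rw [map_zero, map_zero]
  · right
    ext w
    change pairing _ w = pairing _ a ↔ expect w = c
    rw [pairing_const_left, pairing_const_left, ha, mul_right_inj' hk]

end Subregular

end RiskQuadrangle

theorem mainTheorem3 {Ω : Type*} [MeasurableSpace Ω] (μ : Measure Ω) [IsProbabilityMeasure μ]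
    (p q : ℝ≥0∞) [Fact (1 ≤ p)] [Fact (1 ≤ q)] [ENNReal.HolderConjugate p q] (hp : p < ∞)
    (F : Lp ℝ p μ → EReal) (hF : IsClosedProperConvex F)
    (Fc : Lp ℝ q μ → EReal) (hFc : Fc = conjugate F)
    (one : Lp ℝ q μ) (hone : one = Lp.const q μ 1) :
    -- characterizations through the conjugate
    (IsSubregularError F ↔
      (∀ Q, Fc 0 ≤ Fc Q) ∧ Fc 0 = 0 ∧
      ∀ X : Lp ℝ p μ, X ≠ 0 → ∃ Q ∈ effDom Fc, 0 < pairing X Q) ∧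
    (IsSubregularRegret F ↔
      (∀ Q, Fc one ≤ Fc Q) ∧ Fc one = 0 ∧
      ∀ X : Lp ℝ p μ, X ≠ 0 →
        ∃ Q ∈ effDom Fc, expect X < pairing X Q) ∧
    (IsSubregularDeviation F ↔
      (∀ Q, Fc 0 ≤ Fc Q) ∧ Fc 0 = 0 ∧
      (∀ Q ∈ effDom Fc, expect Q = 0) ∧
      ∀ X : Lp ℝ p μ, ¬ IsConstant X →
        ∃ Q ∈ effDom Fc, 0 < pairing X Q) ∧
    (IsSubregularRisk F ↔
      (∀ Q, Fc one ≤ Fc Q) ∧ Fc one = 0 ∧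
      (∀ Q ∈ effDom Fc, expect Q = 1) ∧
      ∀ X : Lp ℝ p μ, ¬ IsConstant X →
        ∃ Q ∈ effDom Fc, expect X < pairing X Q) ∧
    -- the positively homogeneous case
    (IsPosHomogeneous F →
      ∀ (τ : TopologicalSpace (Lp ℝ q μ)), τ = dualTopology p q μ →
      ∀ (𝒬 : Set (Lp ℝ q μ)), 𝒬 = riskEnvelope q F →
      -- the envelope is the domain of the conjugate, and the unique closed convex set
      -- whose support function is `F`
      (𝒬 = effDom Fc ∧
        (∀ C : Set (Lp ℝ q μ),
          ((IsClosed[τ] C ∧ Convex ℝ C ∧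
            ∀ X : Lp ℝ p μ, F X = ⨆ Q ∈ C, (pairing X Q : EReal)) ↔ C = 𝒬))) ∧
      -- analytic form
      (IsSubregularError F ↔
        0 ∈ 𝒬 ∧ ∀ X : Lp ℝ p μ, X ≠ 0 → ∃ Q ∈ 𝒬, 0 < pairing X Q) ∧
      (IsSubregularRegret F ↔
        one ∈ 𝒬 ∧ ∀ X : Lp ℝ p μ, X ≠ 0 →
          ∃ Q ∈ 𝒬, expect X < pairing X Q) ∧
      (IsSubregularDeviation F ↔
        0 ∈ 𝒬 ∧ (∀ Q ∈ 𝒬, expect Q = 0) ∧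
        ∀ X : Lp ℝ p μ, ¬ IsConstant X →
          ∃ Q ∈ 𝒬, 0 < pairing X Q) ∧
      (IsSubregularRisk F ↔
        one ∈ 𝒬 ∧ (∀ Q ∈ 𝒬, expect Q = 1) ∧
        ∀ X : Lp ℝ p μ, ¬ IsConstant X →
          ∃ Q ∈ 𝒬, expect X < pairing X Q) ∧
      -- geometric form: quasi-interior
      (IsSubregularError F ↔
        IsClosed[τ] 𝒬 ∧ Convex ℝ 𝒬 ∧ 0 ∈ quasiInterior τ 𝒬) ∧
      (IsSubregularRegret F ↔
        IsClosed[τ] 𝒬 ∧ Convex ℝ 𝒬 ∧ one ∈ quasiInterior τ 𝒬) ∧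
      (IsSubregularDeviation F ↔
        IsClosed[τ] 𝒬 ∧ Convex ℝ 𝒬 ∧ 𝒬 ⊆ expectHyperplane q μ 0 ∧
        0 ∈ quasiInteriorIn τ (expectHyperplane q μ 0) 𝒬) ∧
      (IsSubregularRisk F ↔
        IsClosed[τ] 𝒬 ∧ Convex ℝ 𝒬 ∧ 𝒬 ⊆ expectHyperplane q μ 1 ∧
        one ∈ quasiInteriorIn τ (expectHyperplane q μ 1) 𝒬) ∧
      -- geometric form: closed hyperplanes
      (IsSubregularError F ↔
        0 ∈ 𝒬 ∧ HyperplanesCut τ 𝒬 0) ∧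
      (IsSubregularRegret F ↔
        one ∈ 𝒬 ∧ HyperplanesCut τ 𝒬 one) ∧
      (IsSubregularDeviation F ↔
        𝒬 ⊆ expectHyperplane q μ 0 ∧ 0 ∈ 𝒬 ∧
        HyperplanesCutExcept τ (expectHyperplane q μ 0) 𝒬 0) ∧
      (IsSubregularRisk F ↔
        𝒬 ⊆ expectHyperplane q μ 1 ∧ one ∈ 𝒬 ∧
        HyperplanesCutExcept τ (expectHyperplane q μ 1) 𝒬 one)) := by
  subst hFc hone
  have hbot := hF.ne_bot
  have hcc := hF.toIsClosedConvex
  have hS : IsSupOfAffineMinorants (pairingₗ p q μ) F := hF.isSupOfAffineMinorants hp.ne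
  have e0 : expect (0 : Lp ℝ q μ) = 0 := expect_zero
  have e1 : expect (Lp.const q μ 1) = 1 := expect_const 1
  have hE := isSubregularError_iff_isAverse (q := q) hcc
  have hV := isSubregularRegret_iff_isAverse (q := q) hcc
  have hD := isSubregularDeviation_iff_isAverse (q := q) hcc
  have hR := isSubregularRisk_iff_isAverse (q := q) hcc
  have H0 := mem_expectHyperplane_iff (p := p) e0
  have H1 := mem_expectHyperplane_iff (p := p) e1
  have Hu : ∀ a w : Lp ℝ q μ, w ∈ (Set.univ : Set (Lp ℝ q μ)) ↔
      ∀ X ∈ (⊥ : Submodule ℝ (Lp ℝ p μ)), pairingₗ p q μ X w = pairingₗ p q μ X a := by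
    intro a w
    simp only [Set.mem_univ, Submodule.mem_bot, forall_eq, map_zero, LinearMap.zero_apply]
  have hdim : ∀ a : Lp ℝ q μ, ∀ X ∈ (⊥ : Submodule ℝ (Lp ℝ p μ)), pairingₗ p q μ X = 0 ∨
      {w | pairingₗ p q μ X w = pairingₗ p q μ X a} = Set.univ := by
    rintro a X rfl
    exact Or.inl (map_zero _)
  refine ⟨?_, ?_, ?_, ?_, ?_⟩
  · rw [hE, isAverse_iff_conjugate hbot hS (Hu 0)]
    simp only [pairing_zero_right, Submodule.mem_bot, Set.mem_univ, implies_true, true_and, ne_eq]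
  · rw [hV, isAverse_iff_conjugate hbot hS (Hu _)]
    simp only [pairing_one_right, Submodule.mem_bot, Set.mem_univ, implies_true, true_and, ne_eq]
  · rw [hD, isAverse_iff_conjugate hbot hS H0]
    simp only [pairing_zero_right, mem_constants_iff]
    rfl
  · rw [hR, isAverse_iff_conjugate hbot hS H1]
    simp only [pairing_one_right, mem_constants_iff]
    rfl
  intro hom τ hτ 𝒬 h𝒬
  have hc : IsCompatibleTopology τ (pairingₗ p q μ) := hτ ▸ isCompatibleTopology_dualTopology
  have hdom : 𝒬 = effDom (conjugate F) := h𝒬.trans (riskEnvelope_eq_effDom_conjugate hbot hom)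
  rw [riskEnvelope_eq_linearMinorants] at h𝒬
  refine ⟨⟨hdom, fun C => ?_⟩, ?_, ?_, ?_, ?_, ?_, ?_, ?_, ?_, ?_, ?_, ?_, ?_⟩
  · rw [h𝒬]; exact supportFunction_iff_eq_linearMinorants hc hS hom C
  · rw [hE, isAverse_iff_linearMinorants hS hom (Hu 0), ← h𝒬]
    simp only [pairingₗ_apply, pairing_zero_right, Submodule.mem_bot, Set.subset_univ,
      true_and, ne_eq]
  · rw [hV, isAverse_iff_linearMinorants hS hom (Hu _), ← h𝒬]
    simp only [pairingₗ_apply, pairing_one_right, Submodule.mem_bot, Set.subset_univ,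
      true_and, ne_eq]
  · rw [hD, isAverse_iff_linearMinorants hS hom H0, ← h𝒬]
    simp only [pairingₗ_apply, pairing_zero_right, mem_constants_iff]
    rfl
  · rw [hR, isAverse_iff_linearMinorants hS hom H1, ← h𝒬]
    simp only [pairingₗ_apply, pairing_one_right, mem_constants_iff]
    rfl
  · rw [hE, isAverse_iff_mem_quasiInteriorIn hc hS hom (Hu 0)
      fun X => mem_bot_of_pairing_eq_zero, ← h𝒬, quasiInterior_eq_quasiInteriorIn_univ]
    simp only [Set.subset_univ, true_and]
  · rw [hV, isAverse_iff_mem_quasiInteriorIn hc hS hom (Hu _)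
      fun X => mem_bot_of_pairing_eq_zero, ← h𝒬, quasiInterior_eq_quasiInteriorIn_univ]
    simp only [Set.subset_univ, true_and]
  · rw [hD, isAverse_iff_mem_quasiInteriorIn hc hS hom H0
      fun X => mem_constants_of_pairing_eq_zero e0, ← h𝒬]
  · rw [hR, isAverse_iff_mem_quasiInteriorIn hc hS hom H1
      fun X => mem_constants_of_pairing_eq_zero e1, ← h𝒬]
  · rw [hE, isAverse_iff_hyperplanesCutExcept hc hS hom (Hu 0)
      (fun X => mem_bot_of_pairing_eq_zero) (hdim 0), ← h𝒬,
      hyperplanesCut_iff_hyperplanesCutExcept_univ]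
    simp only [Set.subset_univ, true_and]
  · rw [hV, isAverse_iff_hyperplanesCutExcept hc hS hom (Hu _)
      (fun X => mem_bot_of_pairing_eq_zero) (hdim _), ← h𝒬,
      hyperplanesCut_iff_hyperplanesCutExcept_univ]
    simp only [Set.subset_univ, true_and]
  · rw [hD, isAverse_iff_hyperplanesCutExcept hc hS hom H0
      (fun X => mem_constants_of_pairing_eq_zero e0) (pairing_const_hyperplane e0), ← h𝒬]
  · rw [hR, isAverse_iff_hyperplanesCutExcept hc hS hom H1
      (fun X => mem_constants_of_pairing_eq_zero e1) (pairing_const_hyperplane e1), ← h𝒬]
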